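/- **Proposition 4.2.** Let $d\in\{2,3\}$, let $\Omega\subset\mathbb{R}^d$ be a bounded domain with smooth boundary $\Gamma$, let $\Omega_0\subseteq\Omega$ be open, and let $P=L^2(\Omega_0)$ or $P=H^1(\Omega_0)$ (real-valued functions). *Data.* Let $g_1,g_2,g_1^\delta,g_2^\delta\in L^\infty(\Gamma)$ be real-valued, and let $\delta>0$ satisfy $\|g_j^\delta-g_j\|_{L^\infty(\Gamma)}\le\delta$ for $j=1,2$. Assume that the exact data are attainable: there are $p^\dagger\in P$ and a real $u\in H^1(\Omega)$ such that, in the weak sense, $-\Delta u+u=p^\dagger\chi_{\Omega_0}$ in $\Omega$, $u=g_1$ and $\partial u/\partial\mathbf n=g_2$ on $\Gamma$ (so in particular $g_1\in H^{1/2}(\Gamma)$). Such a $p^\dagger$ is called an exact source for $(g_1,g_2)$. *Functional.* For $p\in P$ let $u(p)=u_{re}(p)+i\,u_{im}(p)\in H^1(\Omega;\mathbb{C})$ be the weak solution, for the noisy data, of $$-\Delta u+u=p\chi_{\Omega_0}\ \text{in }\Omega,\qquad \frac{\partial u}{\partial\mathbf n}+iu=g_2^\delta+i g_1^\delta\ \text{on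 }\Gamma,$$ and put $V(p)=\tfrac12\|u_{im}(p)\|_{L^2(\Omega)}^2$. *Constant.* Call $C_0\ge0$ an error constant of $\Omega$ if $\|u_{im}(p^\dagger)\|_{L^2(\Omega)}\le C_0\delta$ for all $\Omega_0$, $P$, $\delta$, $g_1,g_2,g_1^\delta,g_2^\delta$ as above and every exact source $p^\dagger\in P$ for $(g_1,g_2)$. (Thus $C_0$ depends on $\Omega$ only.) *Dynamics.* Let either $\eta(t)=\eta\ge1$ be constant and $t_0=0$, or $\eta(t)=r/t$ with $r>3$ and $t_0=1$. For $p_0,\dot p_0\in P$ let $p^\delta:[t_0,\infty)\to P$ be a solution of $$\ddot p^\delta(t)+\eta(t)\,\dot p^\delta(t)+w_{im}(t)=0\ \text{ in }\Omega_0,\ t>t_0,\qquad p^\delta(t_0)=p_0,\quad \dot p^\delta(t_0)=\dot p_0,$$ where $w(t)=w_{re}(t)+i\,w_{im}(t)\in H^1(\Omega;\mathbb{C})$ is the weak solution of $-\Delta w+w=u_{im}(p^\delta(t))$ in $\Omega$, $\partial w/\partial\mathbf n+iw=0$ on $\Gamma$. Here $p^\delta$ is continuously differentiable on $[t_0,\infty)$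 and twice differentiable on $(t_0,\infty)$ as a $P$-valued function. Then $\Omega$ has an error constant, and for every error constant $C_0$ of $\Omega$ the limit $\lim_{t\to\infty}V(p^\delta(t))$ exists and $$\lim_{t\to\infty}V(p^\delta(t))\le C_0^2\,\delta^2 .$$ -/

import Mathlib

open MeasureTheory Set Filter Topology
open scoped ContDiff ENNReal

noncomputable section

namespace InverseSource

/-- The Euclidean space `ℝ^d`. -/
abbrev E (d : ℕ) : Type := EuclideanSpace ℝ (Fin d)

/-- A bounded domain with smooth boundary: a bounded, open, connected (in particular nonempty) set
such that near each of its boundary points a smooth diffeomorphism between open sets straightens it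
to one side of a coordinate hyperplane. -/
structure IsSmoothBoundedDomain {d : ℕ} (Ω : Set (E d)) : Prop where
  isOpen : IsOpen Ω
  isConnected : IsConnected Ω
  isBounded : Bornology.IsBounded Ω
  smooth_boundary : ∀ x ∈ frontier Ω, ∃ (Φ : OpenPartialHomeomorph (E d) (E d)) (i : Fin d),
    x ∈ Φ.source ∧ ContDiffOn ℝ ∞ Φ Φ.source ∧ ContDiffOn ℝ ∞ Φ.symm Φ.target ∧
      ∀ y ∈ Φ.source, (y ∈ Ω ↔ 0 < Φ y i)

/-- Surface measure on the boundary `Γ = ∂Ω`: the `(d-1)`-dimensional Hausdorff measure, normalised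
so as to agree with Lebesgue measure on hyperplanes. -/
def surf {d : ℕ} (Ω : Set (E d)) : Measure (E d) :=
  (Measure.euclideanHausdorffMeasure (d - 1)).restrict (frontier Ω)

/-- The classical partial derivative `∂φ/∂x_i`. -/
def pd {d : ℕ} {F : Type*} [NormedAddCommGroup F] [NormedSpace ℝ F]
    (i : Fin d) (φ : E d → F) (x : E d) : F :=
  fderiv ℝ φ x (EuclideanSpace.single i 1)

/-- `G = (G_1, …, G_d)` is the weak gradient of `u` in the open set `U`. -/
def HasWeakGradient {d : ℕ} {𝕜 : Type*} [RCLike 𝕜] (U : Set (E d)) (u : E d → 𝕜)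
    (G : Fin d → E d → 𝕜) : Prop :=
  ∀ φ : E d → ℝ, ContDiff ℝ ∞ φ → HasCompactSupport φ → tsupport φ ⊆ U →
    ∀ i, ∫ x in U, pd i φ x • u x = - ∫ x in U, φ x • G i x

/-- `u ∈ H¹(U)` (real if `𝕜 = ℝ`, complex if `𝕜 = ℂ`) and `G` is its weak gradient. -/
def MemH1 {d : ℕ} {𝕜 : Type*} [RCLike 𝕜] (U : Set (E d)) (u : E d → 𝕜)
    (G : Fin d → E d → 𝕜) : Prop :=
  MemLp u 2 (volume.restrict U) ∧ (∀ i, MemLp (G i) 2 (volume.restrict U)) ∧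
    HasWeakGradient U u G

/-- `u ∈ H¹(Ω)` with weak gradient `G`, and `τ ∈ L²(Γ)` is the trace of `u` on `Γ = ∂Ω`: some
sequence of functions that are smooth up to the boundary converges to `u` in `H¹(Ω)`, while their
restrictions to `Γ` converge to `τ` in `L²(Γ)`. -/
def HasTrace {d : ℕ} {𝕜 : Type*} [RCLike 𝕜] (Ω : Set (E d)) (u : E d → 𝕜)
    (G : Fin d → E d → 𝕜) (τ : E d → 𝕜) : Prop :=
  MemH1 Ω u G ∧ MemLp τ 2 (surf Ω) ∧
    ∃ φ : ℕ → E d → 𝕜, (∀ n, ContDiff ℝ ∞ (φ n)) ∧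
      Tendsto (fun n => eLpNorm (φ n - u) 2 (volume.restrict Ω)) atTop (𝓝 0) ∧
      (∀ i, Tendsto (fun n => eLpNorm (pd i (φ n) - G i) 2 (volume.restrict Ω)) atTop (𝓝 0)) ∧
      Tendsto (fun n => eLpNorm (φ n - τ) 2 (surf Ω)) atTop (𝓝 0)

/-- `u ∈ H¹(Ω; ℂ)` is the weak solution of
`-Δu + u = f` in `Ω`, `∂u/∂n + i u = h` on `Γ`, that is, `a(u, ψ) = ∫_Ω f ψ̄ + ∫_Γ h ψ̄` for all
`ψ ∈ H¹(Ω; ℂ)`, where `a(u, ψ) = ∫_Ω (∇u · ∇ψ̄ + u ψ̄) + i ∫_Γ u ψ̄`. -/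
def IsRobinSolution {d : ℕ} (Ω : Set (E d)) (f : E d → ℝ) (h : E d → ℂ) (u : E d → ℂ) : Prop :=
  ∃ (G : Fin d → E d → ℂ) (τ : E d → ℂ), HasTrace Ω u G τ ∧
    ∀ (ψ : E d → ℂ) (H : Fin d → E d → ℂ) (θ : E d → ℂ), HasTrace Ω ψ H θ →
      (∫ x in Ω, ((∑ i, G i x * starRingEnd ℂ (H i x)) + u x * starRingEnd ℂ (ψ x)))
          + Complex.I * ∫ s, τ s * starRingEnd ℂ (θ s) ∂(surf Ω)
        = (∫ x in Ω, (f x : ℂ) * starRingEnd ℂ (ψ x))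
          + ∫ s, h s * starRingEnd ℂ (θ s) ∂(surf Ω)

/-- The real space `L²(U)`. -/
abbrev L2 {d : ℕ} (U : Set (E d)) : Type := Lp ℝ 2 (volume.restrict U)

/-- A smooth compactly supported function times an `L²` function is integrable. -/
lemma integrable_smul_of_memLp {d : ℕ} {U : Set (E d)} {g : E d → ℝ} (hg : Continuous g)
    (hc : HasCompactSupport g) {f : E d → ℝ} (hf : MemLp f 2 (volume.restrict U)) :
    Integrable (fun x => g x • f x) (volume.restrict U) := by
  have h1 : MemLp g 2 (volume.restrict U) :=
    (hg.memLp_of_hasCompactSupport hc (μ := volume) (p := 2)).restrict U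
  exact h1.integrable_mul hf

lemma continuous_pd {d : ℕ} {φ : E d → ℝ} (h : ContDiff ℝ ∞ φ) (i : Fin d) :
    Continuous (pd i φ) :=
  (h.continuous_fderiv (by simp)).clm_apply continuous_const

lemma hasCompactSupport_pd {d : ℕ} {φ : E d → ℝ} (h : HasCompactSupport φ) (i : Fin d) :
    HasCompactSupport (pd i φ) :=
  h.fderiv_apply (𝕜 := ℝ) _

/-- The real Hilbert space `H¹(U)` with `‖u‖² = ‖u‖²_{L²} + ∑ᵢ ‖∂ᵢu‖²_{L²}`, realised as the space
of pairs (function, weak gradient). -/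
def H1 {d : ℕ} (U : Set (E d)) :
    Submodule ℝ (WithLp 2 (L2 U × PiLp 2 (fun _ : Fin d => L2 U))) where
  carrier := {z | HasWeakGradient U (z.fst : E d → ℝ) (fun i => (z.snd i : E d → ℝ))}
  zero_mem' := by
    intro φ _ _ _ i
    have h0 : ((0 : L2 U) : E d → ℝ) =ᵐ[volume.restrict U] 0 := Lp.coeFn_zero _ _ _
    have h1 : ∀ g : E d → ℝ, ∫ x in U, g x • ((0 : L2 U) : E d → ℝ) x = 0 := by
      intro g
      rw [integral_eq_zero_of_ae]
      filter_upwards [h0] with x hx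
      rw [hx]
      exact smul_zero _
    refine (h1 (pd i φ)).trans ?_
    exact (neg_eq_zero.mpr (h1 φ)).symm
  add_mem' := by
    intro a b ha hb φ h1 h2 h3 i
    have key : ∀ (f g : L2 U) (χ : E d → ℝ), Continuous χ → HasCompactSupport χ →
        ∫ x in U, χ x • ((f + g : L2 U) : E d → ℝ) x
          = (∫ x in U, χ x • (f : E d → ℝ) x) + ∫ x in U, χ x • (g : E d → ℝ) x := by
      intro f g χ hχ hc
      rw [← integral_add (integrable_smul_of_memLp hχ hc (Lp.memLp f))
        (integrable_smul_of_memLp hχ hc (Lp.memLp g))]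
      refine integral_congr_ae ?_
      filter_upwards [Lp.coeFn_add f g] with x hx
      rw [hx]
      exact smul_add _ _ _
    have e1 := key a.fst b.fst (pd i φ) (continuous_pd h1 i) (hasCompactSupport_pd h2 i)
    have e2 := key (a.snd i) (b.snd i) φ h1.continuous h2
    have ea := ha φ h1 h2 h3 i
    have eb := hb φ h1 h2 h3 i
    refine e1.trans ?_
    rw [ea, eb, ← neg_add]
    exact congrArg Neg.neg e2.symm
  smul_mem' := by
    intro c a ha φ h1 h2 h3 i
    have key : ∀ (f : L2 U) (χ : E d → ℝ),
        ∫ x in U, χ x • ((c • f : L2 U) : E d → ℝ) x = c * ∫ x in U, χ x • (f : E d → ℝ) x := by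
      intro f χ
      rw [← integral_const_mul]
      refine integral_congr_ae ?_
      filter_upwards [Lp.coeFn_smul c f] with x hx
      simp only [hx, Pi.smul_apply, smul_eq_mul]
      ring
    have ea := ha φ h1 h2 h3 i
    refine (key a.fst (pd i φ)).trans ?_
    rw [ea, mul_neg]
    exact congrArg Neg.neg (key (a.snd i) φ).symm

/-- The two choices for the source space `P`. -/
inductive SourceKind
  | L2
  | H1

/-- The source space `P`: either `L²(Ω₀)` or `H¹(Ω₀)`. -/
def SourceSpace {d : ℕ} (Ω₀ : Set (E d)) : SourceKind → Type
  | .L2 => L2 Ω₀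
  | .H1 => H1 Ω₀

instance {d : ℕ} (Ω₀ : Set (E d)) (k : SourceKind) : NormedAddCommGroup (SourceSpace Ω₀ k) :=
  match k with
  | .L2 => inferInstanceAs (NormedAddCommGroup (L2 Ω₀))
  | .H1 => inferInstanceAs (NormedAddCommGroup (H1 Ω₀))

instance {d : ℕ} (Ω₀ : Set (E d)) (k : SourceKind) : NormedSpace ℝ (SourceSpace Ω₀ k) :=
  match k with
  | .L2 => inferInstanceAs (NormedSpace ℝ (L2 Ω₀))
  | .H1 => inferInstanceAs (NormedSpace ℝ (H1 Ω₀))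

/-- The inclusion `P ⊆ L²(Ω₀)`. -/
def toL2 {d : ℕ} {Ω₀ : Set (E d)} : {k : SourceKind} → SourceSpace Ω₀ k → L2 Ω₀
  | .L2, p => p
  | .H1, p => (Subtype.val p).fst

/-- The source term `p χ_{Ω₀}`, a function on `ℝ^d`. -/
def sourceTerm {d : ℕ} {Ω₀ : Set (E d)} {k : SourceKind} (p : SourceSpace Ω₀ k) : E d → ℝ :=
  Ω₀.indicator (toL2 p : E d → ℝ)

/-- The complex Robin datum `g₂ + i g₁`. -/
def robinData {d : ℕ} (g₁ g₂ : E d → ℝ) (s : E d) : ℂ := (g₂ s : ℂ) + Complex.I * (g₁ s : ℂ)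

/-- `u` is the state `u(p)`: the weak solution of `-Δu + u = p χ_{Ω₀}` in `Ω`,
`∂u/∂n + i u = g₂ + i g₁` on `Γ`. -/
def IsState {d : ℕ} (Ω : Set (E d)) {Ω₀ : Set (E d)} {k : SourceKind} (g₁ g₂ : E d → ℝ)
    (p : SourceSpace Ω₀ k) (u : E d → ℂ) : Prop :=
  IsRobinSolution Ω (sourceTerm p) (robinData g₁ g₂) u

/-- The state `u(p)` (which exists and is unique almost everywhere for square integrable data). -/
def state {d : ℕ} (Ω : Set (E d)) {Ω₀ : Set (E d)} {k : SourceKind} (g₁ g₂ : E d → ℝ)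
    (p : SourceSpace Ω₀ k) : E d → ℂ :=
  Classical.epsilon (IsState Ω g₁ g₂ p)

/-- `‖u_im(p)‖_{0,Ω}`. -/
def stateImNorm {d : ℕ} (Ω : Set (E d)) {Ω₀ : Set (E d)} {k : SourceKind} (g₁ g₂ : E d → ℝ)
    (p : SourceSpace Ω₀ k) : ℝ :=
  Real.sqrt (∫ x in Ω, (state Ω g₁ g₂ p x).im ^ 2)

/-- The objective functional `V(p) = ½ ‖u_im(p)‖²_{0,Ω}`. -/
def V {d : ℕ} (Ω : Set (E d)) {Ω₀ : Set (E d)} {k : SourceKind} (g₁ g₂ : E d → ℝ)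
    (p : SourceSpace Ω₀ k) : ℝ :=
  1 / 2 * stateImNorm Ω g₁ g₂ p ^ 2

/-- `p` is an exact source for the boundary data `g₁, g₂`: there is a real `u ∈ H¹(Ω)` which solves
`-Δu + u = p χ_{Ω₀}` in `Ω`, `u = g₁` and `∂u/∂n = g₂` on `Γ` in the weak sense. -/
def IsExactSource {d : ℕ} (Ω : Set (E d)) {Ω₀ : Set (E d)} {k : SourceKind} (g₁ g₂ : E d → ℝ)
    (p : SourceSpace Ω₀ k) : Prop :=
  ∃ (u : E d → ℝ) (G : Fin d → E d → ℝ), HasTrace Ω u G g₁ ∧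
    ∀ (ψ : E d → ℝ) (H : Fin d → E d → ℝ) (θ : E d → ℝ), HasTrace Ω ψ H θ →
      ∫ x in Ω, ((∑ i, G i x * H i x) + u x * ψ x)
        = (∫ x in Ω, sourceTerm p x * ψ x) + ∫ s, g₂ s * θ s ∂(surf Ω)

/-- Bounded exact data `g₁, g₂` and noisy data `g₁δ, g₂δ` on `Γ`, with error level `δ > 0` in
`L^∞(Γ)`. -/
structure IsNoisyData {d : ℕ} (Ω : Set (E d)) (g₁ g₂ g₁δ g₂δ : E d → ℝ) (δ : ℝ) : Prop where
  pos : 0 < δ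
  exact₁ : MemLp g₁ ∞ (surf Ω)
  exact₂ : MemLp g₂ ∞ (surf Ω)
  noisy₁ : MemLp g₁δ ∞ (surf Ω)
  noisy₂ : MemLp g₂δ ∞ (surf Ω)
  error₁ : eLpNorm (g₁δ - g₁) ∞ (surf Ω) ≤ ENNReal.ofReal δ
  error₂ : eLpNorm (g₂δ - g₂) ∞ (surf Ω) ≤ ENNReal.ofReal δ

/-- `C₀` is an admissible error constant of the domain `Ω`: whatever the permissible region, the
source space, the data and the exact source `p†`, the state for the noisy data satisfies
`‖u_im(p†)‖_{0,Ω} ≤ C₀ δ`. -/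
def IsErrorConstant {d : ℕ} (Ω : Set (E d)) (C₀ : ℝ) : Prop :=
  0 ≤ C₀ ∧ ∀ (Ω₀ : Set (E d)), IsOpen Ω₀ → Ω₀ ⊆ Ω → ∀ (k : SourceKind)
    (g₁ g₂ g₁δ g₂δ : E d → ℝ) (δ : ℝ), IsNoisyData Ω g₁ g₂ g₁δ g₂δ δ →
      ∀ p : SourceSpace Ω₀ k, IsExactSource Ω g₁ g₂ p → stateImNorm Ω g₁δ g₂δ p ≤ C₀ * δ

/-- The two damping regimes: a constant `η ≥ 1`, with initial time `0`, or `η(t) = r / t` with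
`r > 3`, with initial time `1`. -/
def IsDamping (t₀ : ℝ) (η : ℝ → ℝ) : Prop :=
  (t₀ = 0 ∧ ∃ c : ℝ, 1 ≤ c ∧ η = fun _ => c) ∨ (t₀ = 1 ∧ ∃ r : ℝ, 3 < r ∧ η = fun t => r / t)

/-- `p : [t₀, ∞) → P` is the dynamic solution with initial data `p₀, q₀`:
`p̈ + η(t) ṗ + w_im = 0` in `Ω₀` for `t > t₀`, `p(t₀) = p₀`, `ṗ(t₀) = q₀`, where `u(t)` is the state
of `p(t)` and `w(t)` is the weak solution of `-Δw + w = u_im(t)` in `Ω`, `∂w/∂n + i w = 0` on `Γ`.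
Here `v = ṗ` and `a = p̈`, as derivatives of `P`-valued functions. -/
def IsDynamicSolution {d : ℕ} (Ω : Set (E d)) {Ω₀ : Set (E d)} {k : SourceKind}
    (g₁ g₂ : E d → ℝ) (t₀ : ℝ) (η : ℝ → ℝ) (p₀ q₀ : SourceSpace Ω₀ k)
    (p : ℝ → SourceSpace Ω₀ k) : Prop :=
  ∃ v a : ℝ → SourceSpace Ω₀ k,
    p t₀ = p₀ ∧ v t₀ = q₀ ∧ ContinuousOn v (Ici t₀) ∧
    (∀ t ∈ Ici t₀, HasDerivWithinAt p (v t) (Ici t₀) t) ∧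
    (∀ t ∈ Ioi t₀, HasDerivAt v (a t) t) ∧
    ∀ t ∈ Ioi t₀, ∃ u w : E d → ℂ,
      IsState Ω g₁ g₂ (p t) u ∧ IsRobinSolution Ω (fun x => (u x).im) (fun _ => 0) w ∧
      ∀ᵐ x ∂(volume.restrict Ω₀),
        (toL2 (a t) : E d → ℝ) x + η t * (toL2 (v t) : E d → ℝ) x + (w x).im = 0

end InverseSource

end

noncomputable section

namespace InverseSource

open scoped InnerProductSpace ComplexConjugate

/-- The isometric embedding of `ℝⁿ` onto the coordinate hyperplane `{y | y i = 0}` of `ℝⁿ⁺¹`. -/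
def hyperplaneEmbedding {n : ℕ} (i : Fin (n + 1)) (y : E n) : E (n + 1) :=
  WithLp.toLp 2 (i.insertNth (0 : ℝ) (fun j => y j))

lemma isometry_hyperplaneEmbedding {n : ℕ} (i : Fin (n + 1)) :
    Isometry (hyperplaneEmbedding i) := by
  refine Isometry.of_dist_eq fun x y => ?_
  rw [EuclideanSpace.dist_eq, EuclideanSpace.dist_eq, Fin.sum_univ_succAbove _ i]
  simp [hyperplaneEmbedding]

lemma exists_hyperplaneEmbedding_eq {n : ℕ} {i : Fin (n + 1)} {z : E (n + 1)} (hz : z i = 0) :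
    ∃ y, hyperplaneEmbedding i y = z := by
  refine ⟨WithLp.toLp 2 fun j => z (i.succAbove j), ?_⟩
  ext k
  rcases Fin.eq_self_or_eq_succAbove i k with rfl | ⟨j, rfl⟩ <;> simp [hyperplaneEmbedding, hz]

lemma euclideanHausdorffMeasure_hyperplane_lt_top {n : ℕ} (i : Fin (n + 1)) {S : Set (E (n + 1))}
    (hS : Bornology.IsBounded S) (h0 : ∀ z ∈ S, z i = 0) :
    Measure.euclideanHausdorffMeasure n S < (⊤ : ℝ≥0∞) := by
  have h1 : S = hyperplaneEmbedding i '' (hyperplaneEmbedding i ⁻¹' S) := by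
    refine (image_preimage_eq_of_subset fun z hz => ?_).symm
    exact exists_hyperplaneEmbedding_eq (h0 z hz)
  rw [h1, (isometry_hyperplaneEmbedding i).euclideanHausdorffMeasure_image,
    EuclideanSpace.euclideanHausdorffMeasure_eq_volume]
  exact ((isometry_hyperplaneEmbedding i).antilipschitz.isBounded_preimage hS).measure_lt_top

lemma _root_.LipschitzOnWith.euclideanHausdorffMeasure_image_le {X Y : Type*} [MetricSpace X]
    [MetricSpace Y] [MeasurableSpace X] [BorelSpace X] [MeasurableSpace Y] [BorelSpace Y]
    {K : NNReal} {f : X → Y} {s : Set X} (h : LipschitzOnWith K f s) (n : ℕ) :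
    Measure.euclideanHausdorffMeasure n (f '' s)
      ≤ (K : ℝ≥0∞) ^ (n : ℝ) * Measure.euclideanHausdorffMeasure n s := by
  simp_rw [Measure.euclideanHausdorffMeasure_def, Measure.smul_apply, ENNReal.smul_def, smul_eq_mul]
  rw [mul_left_comm]
  gcongr
  exact h.hausdorffMeasure_image_le (Nat.cast_nonneg n)

/-- The surface measure of a bounded smooth domain is finite. -/
lemma IsSmoothBoundedDomain.isFiniteMeasure_surf {n : ℕ} {Ω : Set (E (n + 1))}
    (hΩ : IsSmoothBoundedDomain Ω) : IsFiniteMeasure (surf Ω) := by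
  have hc : IsCompact (frontier Ω) :=
    Metric.isCompact_of_isClosed_isBounded isClosed_frontier
      (hΩ.isBounded.closure.subset frontier_subset_closure)
  refine ⟨?_⟩
  rw [surf, Measure.restrict_apply_univ, Nat.add_sub_cancel]
  refine hc.measure_lt_top_of_nhdsWithin fun x hx => ?_
  obtain ⟨Φ, i, hxs, -, hΦ, hpos⟩ := hΩ.smooth_boundary x hx
  have hg : ContDiffAt ℝ 1 Φ.symm (Φ x) :=
    ((hΦ.contDiffAt (Φ.open_target.mem_nhds (Φ.map_source hxs))).of_le (by simp))
  obtain ⟨K, T, hT, hK⟩ := hg.exists_lipschitzOnWith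
  have hN : Φ.source ∩ Φ ⁻¹' (T ∩ Metric.ball (Φ x) 1) ∈ 𝓝 x :=
    inter_mem (Φ.open_source.mem_nhds hxs)
      ((Φ.continuousAt hxs).preimage_mem_nhds (inter_mem hT (Metric.ball_mem_nhds _ one_pos)))
  refine ⟨_, inter_mem_nhdsWithin _ hN, ?_⟩
  have hzero : ∀ y ∈ frontier Ω, y ∈ Φ.source → Φ y i = 0 := by
    intro y hy hys
    apply le_antisymm
    · have hn : y ∉ Ω := fun h => (hΩ.isOpen.frontier_eq ▸ hy).2 h
      exact not_lt.mp fun h => hn ((hpos y hys).2 h)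
    · have hcont : ContinuousAt (fun z => Φ z i) y :=
        (EuclideanSpace.proj (𝕜 := ℝ) i).continuous.continuousAt.comp (Φ.continuousAt hys)
      by_contra! hneg
      obtain ⟨z, ⟨hz1, hz2⟩, hz⟩ := mem_closure_iff_nhds.1 (frontier_subset_closure hy) _
        (inter_mem (hcont.eventually_lt continuousAt_const hneg) (Φ.open_source.mem_nhds hys))
      exact absurd ((hpos z hz2).1 hz) (not_lt.mpr (le_of_lt hz1))
  set S : Set (E (n + 1)) := {z | z ∈ T ∩ Metric.ball (Φ x) 1 ∧ z i = 0}
  have hsub : frontier Ω ∩ (Φ.source ∩ Φ ⁻¹' (T ∩ Metric.ball (Φ x) 1)) ⊆ Φ.symm '' S := by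
    rintro y ⟨hy, hys, hyT⟩
    exact ⟨Φ y, ⟨hyT, hzero y hy hys⟩, Φ.left_inv hys⟩
  refine (measure_mono hsub).trans_lt ?_
  have hKS : LipschitzOnWith K Φ.symm S := hK.mono fun z (hz : z ∈ S) => hz.1.1
  refine (hKS.euclideanHausdorffMeasure_image_le n).trans_lt ?_
  refine ENNReal.mul_lt_top (ENNReal.rpow_lt_top_of_nonneg (Nat.cast_nonneg n) (by simp)) ?_
  exact euclideanHausdorffMeasure_hyperplane_lt_top i
    (Metric.isBounded_ball.subset fun z (hz : z ∈ S) => hz.1.2) fun z hz => hz.2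

/-- A nonnegative function cannot have derivative `≤ -1` on a whole half-line. -/
lemma not_forall_deriv_le_neg_one {h h' : ℝ → ℝ} {T : ℝ} (h0 : ∀ t, T ≤ t → 0 ≤ h t)
    (hd : ∀ t, T ≤ t → HasDerivAt h (h' t) t) (hle : ∀ t, T ≤ t → h' t ≤ -1) : False := by
  have hanti : AntitoneOn (fun t => h t + t) (Ici T) := by
    refine antitoneOn_of_hasDerivWithinAt_nonpos (f' := fun t => h' t + 1) (convex_Ici T)
      (fun t ht => ((hd t ht).add (hasDerivAt_id t)).continuousAt.continuousWithinAt)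
      (fun t ht => ?_) (fun t ht => ?_)
    · rw [interior_Ici] at ht
      exact ((hd t ht.le).add (hasDerivAt_id t)).hasDerivWithinAt
    · rw [interior_Ici] at ht
      linarith [hle t ht.le]
  have h1 := h0 T le_rfl
  have hT : T ≤ T + h T + 1 := by linarith
  have h2 := hanti (mem_Ici.2 le_rfl) (mem_Ici.2 hT) hT
  simp only at h2
  linarith [h0 _ hT]

/-- A function with nonpositive derivative on `[T, ∞)` is antitone there. -/
lemma antitoneOn_Ici_of_hasDerivAt_nonpos {h h' : ℝ → ℝ} {T : ℝ}
    (hd : ∀ t, T ≤ t → HasDerivAt h (h' t) t) (hle : ∀ t, T ≤ t → h' t ≤ 0) :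
    AntitoneOn h (Ici T) := by
  refine antitoneOn_of_hasDerivWithinAt_nonpos (f' := h') (convex_Ici T)
      (fun t ht => (hd t ht).continuousAt.continuousWithinAt) (fun t ht => ?_) (fun t ht => ?_)
  · rw [interior_Ici] at ht
    exact (hd t ht.le).hasDerivWithinAt
  · rw [interior_Ici] at ht
    exact hle t ht.le

/-- Second order dynamics with vanishing or constant damping for a convex quadratic functional:
the values of the functional converge to its infimum. -/
theorem tendsto_quadratic_of_damped_flow {H F : Type*} [NormedAddCommGroup H]
    [InnerProductSpace ℝ H] [NormedAddCommGroup F] [InnerProductSpace ℝ F] (A : H →L[ℝ] F) (b : F)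
    {p v a : ℝ → H} {t₀ : ℝ} {η : ℝ → ℝ} (hη : IsDamping t₀ η)
    (hp : ∀ t, t₀ < t → HasDerivAt p (v t) t) (hv : ∀ t, t₀ < t → HasDerivAt v (a t) t)
    (heq : ∀ t, t₀ < t → ∀ q : H, ⟪a t + η t • v t, q⟫_ℝ = -⟪A (p t) + b, A q⟫_ℝ) :
    ∃ L : ℝ, Tendsto (fun t => 1 / 2 * ‖A (p t) + b‖ ^ 2) atTop (𝓝 L) ∧
      ∀ z : H, L ≤ 1 / 2 * ‖A z + b‖ ^ 2 := by
  set J : H → ℝ := fun z => 1 / 2 * ‖A z + b‖ ^ 2 with hJ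
  have hJ0 : ∀ z, 0 ≤ J z := fun z => by positivity
  set W : ℝ → ℝ := fun t => J (p t) + 1 / 2 * ‖v t‖ ^ 2 with hW
  have hJW : ∀ t, J (p t) ≤ W t := fun t => le_add_of_nonneg_right (by positivity)
  have hW0 : ∀ t, 0 ≤ W t := fun t => (hJ0 _).trans (hJW t)
  have heq' : ∀ t, t₀ < t → ∀ q : H,
      ⟪a t, q⟫_ℝ = -⟪A (p t) + b, A q⟫_ℝ - η t * ⟪v t, q⟫_ℝ := by
    intro t ht q
    have := heq t ht q
    rw [inner_add_left, real_inner_smul_left] at this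
    linarith
  have hWd : ∀ t, t₀ < t → HasDerivAt W (-η t * ‖v t‖ ^ 2) t := by
    intro t ht
    have h1 : HasDerivAt (fun t => A (p t) + b) (A (v t)) t :=
      (A.hasFDerivAt.comp_hasDerivAt t (hp t ht)).add_const b
    have h2 := (h1.norm_sq.const_mul (1 / 2)).add ((hv t ht).norm_sq.const_mul (1 / 2))
    refine h2.congr_deriv ?_
    rw [real_inner_comm (a t) (v t), heq' t ht, real_inner_self_eq_norm_sq]
    ring
  have hconv : ∀ t z, J (p t) - J z ≤ ⟪A (p t) + b, A (p t - z)⟫_ℝ := by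
    intro t z
    have h1 : A z + b = (A (p t) + b) - A (p t - z) := by rw [map_sub]; abel
    have h2 := norm_sub_sq_real (A (p t) + b) (A (p t - z))
    simp only [hJ]
    rw [h1, h2]
    nlinarith [sq_nonneg ‖A (p t - z)‖]
  set T : ℝ := t₀ + 1 with hT
  have hlt : ∀ t, T ≤ t → t₀ < t := fun t ht => by linarith
  have hηpos : ∀ t, T ≤ t → 0 ≤ η t := by
    rcases hη with ⟨h0, c, hc, rfl⟩ | ⟨h0, r, hr, rfl⟩
    · exact fun _ _ => by linarith
    · exact fun t ht => div_nonneg (by linarith) (by linarith)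
  have hWanti : AntitoneOn W (Ici T) :=
    antitoneOn_Ici_of_hasDerivAt_nonpos (fun t ht => hWd t (hlt t ht)) fun t ht => by
      have := mul_nonneg (hηpos t ht) (sq_nonneg ‖v t‖)
      linarith
  obtain ⟨L, hL, hLW⟩ : ∃ L, Tendsto W atTop (𝓝 L) ∧ ∀ t, T ≤ t → L ≤ W t := by
    have hmono : Antitone fun t => W (max t T) := fun s t hst =>
      hWanti (mem_Ici.2 (le_max_right _ _)) (mem_Ici.2 (le_max_right _ _)) (max_le_max_right T hst)
    have hbdd : BddBelow (range fun t => W (max t T)) := ⟨0, by rintro _ ⟨t, rfl⟩; exact hW0 _⟩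
    refine ⟨_, (tendsto_atTop_ciInf hmono hbdd).congr' ?_, fun t ht => ?_⟩
    · filter_upwards [eventually_ge_atTop T] with t ht
      rw [max_eq_left ht]
    · exact (ciInf_le hbdd t).trans (by rw [max_eq_left ht])
  have hmin : ∀ z, L ≤ J z := by
    intro z
    by_contra! hlt'
    set ε : ℝ := L - J z with hε
    have hεpos : 0 < ε := sub_pos.2 hlt'
    set h : ℝ → ℝ := fun t => 1 / 2 * ‖p t - z‖ ^ 2 with hh
    set k : ℝ → ℝ := fun t => ⟪p t - z, v t⟫_ℝ with hk
    have hh0 : ∀ t, 0 ≤ h t := fun t => by positivity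
    have hhd : ∀ t, T ≤ t → HasDerivAt h (k t) t := by
      intro t ht
      refine (((hp t (hlt t ht)).sub_const z).norm_sq.const_mul (1 / 2)).congr_deriv ?_
      simp only [hk]; ring
    have hkd : ∀ t, T ≤ t →
        HasDerivAt k (⟪p t - z, a t⟫_ℝ + ⟪v t, v t⟫_ℝ) t := fun t ht =>
      ((hp t (hlt t ht)).sub_const z).inner ℝ (hv t (hlt t ht))
    have hkle : ∀ t, T ≤ t → ⟪p t - z, a t⟫_ℝ + ⟪v t, v t⟫_ℝ + η t * k t
        ≤ 3 / 2 * ‖v t‖ ^ 2 - (W t - J z) := by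
      intro t ht
      rw [real_inner_comm, heq' t (hlt t ht), real_inner_comm (p t - z) (v t),
        real_inner_self_eq_norm_sq]
      have := hconv t z
      simp only [hW, hk]
      linarith
    have hεW : ∀ t, T ≤ t → ε ≤ W t - J z := fun t ht => by linarith [hLW t ht]
    rcases hη with ⟨h0, c, hc, rfl⟩ | ⟨h0, r, hr, rfl⟩
    · set Φ : ℝ → ℝ := fun t => k t + c * h t + 3 / 2 * W t + ε * t with hΦ
      have hanti : AntitoneOn Φ (Ici T) := by
        refine antitoneOn_Ici_of_hasDerivAt_nonpos (fun t ht => (((hkd t ht).add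
          ((hhd t ht).const_mul c)).add ((hWd t (hlt t ht)).const_mul (3 / 2))).add
          ((hasDerivAt_id t).const_mul ε)) fun t ht => ?_
        have h1 := hkle t ht
        have h2 := hεW t ht
        have h3 := mul_le_mul_of_nonneg_right hc (sq_nonneg ‖v t‖)
        simp only at h1 ⊢
        linarith
      refine not_forall_deriv_le_neg_one (h := h) (h' := k) (T := max T ((Φ T + 1) / ε))
        (fun t _ => hh0 t) (fun t ht => hhd t ((le_max_left _ _).trans ht)) fun t ht => ?_
      have hTt : T ≤ t := (le_max_left _ _).trans ht
      have h1 : Φ t ≤ Φ T := hanti (mem_Ici.2 le_rfl) hTt hTt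
      have h2 : Φ T + 1 ≤ ε * t := by
        rw [mul_comm]; exact (div_le_iff₀ hεpos).1 ((le_max_right _ _).trans ht)
      have h3 := mul_nonneg (by linarith : (0 : ℝ) ≤ c) (hh0 t)
      have h4 : Φ t = k t + c * h t + 3 / 2 * W t + ε * t := rfl
      linarith [hW0 t]
    · set m : ℝ := (1 - 3 / r) * ε with hm
      have hr0 : 0 < r := by linarith
      have hmpos : 0 < m := mul_pos (by rw [sub_pos, div_lt_one hr0]; exact hr) hεpos
      set Φ : ℝ → ℝ := fun t =>
        t * k t + (r - 1) * h t + 3 / (2 * r) * (t ^ 2 * (W t - J z)) + m / 2 * t ^ 2 with hΦ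
      have hanti : AntitoneOn Φ (Ici T) := by
        refine antitoneOn_Ici_of_hasDerivAt_nonpos (fun t ht => ((((hasDerivAt_id t).mul (hkd t ht)).add
          ((hhd t ht).const_mul (r - 1))).add (((hasDerivAt_pow 2 t).mul
          ((hWd t (hlt t ht)).sub_const (J z))).const_mul (3 / (2 * r)))).add
          ((hasDerivAt_pow 2 t).const_mul (m / 2))) fun t ht => ?_
        have htpos : 0 < t := by linarith
        have h1 := mul_le_mul_of_nonneg_left (hkle t ht) htpos.le
        have h2 := mul_le_mul_of_nonneg_left (hεW t ht) htpos.le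
        have h3 : (1 - 3 / r) * (t * ε) ≤ (1 - 3 / r) * (t * (W t - J z)) :=
          mul_le_mul_of_nonneg_left h2 (by rw [sub_nonneg, div_le_one hr0]; exact hr.le)
        have e1 : t * (⟪p t - z, a t⟫_ℝ + ⟪v t, v t⟫_ℝ + r / t * k t)
            = t * (⟪p t - z, a t⟫_ℝ + ⟪v t, v t⟫_ℝ) + r * k t := by
          field_simp
        have e2 : 3 / (2 * r) * (t ^ 2 * (-(r / t) * ‖v t‖ ^ 2)) = - (3 / 2 * t * ‖v t‖ ^ 2) := by
          field_simp
        have e3 : 3 / (2 * r) * (2 * t * (W t - J z)) = 3 / r * (t * (W t - J z)) := by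
          field_simp
        simp only at h1
        rw [e1] at h1
        simp only [id, Nat.cast_ofNat, Nat.add_one_sub_one, pow_one, mul_add] at *
        rw [e2, e3]
        simp only [hm]
        linarith
      refine not_forall_deriv_le_neg_one (h := h) (h' := k)
        (T := max T ((|Φ T| + 1) / (m / 2)))
        (fun t _ => hh0 t) (fun t ht => hhd t ((le_max_left _ _).trans ht)) fun t ht => ?_
      have hTt : T ≤ t := (le_max_left _ _).trans ht
      have h1t : 1 ≤ t := by linarith
      have h1 : Φ t ≤ Φ T := hanti (mem_Ici.2 le_rfl) hTt hTt
      have h2 : |Φ T| + 1 ≤ m / 2 * t := by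
        rw [mul_comm]; exact (div_le_iff₀ (by linarith)).1 ((le_max_right _ _).trans ht)
      have h3 := mul_nonneg (by linarith : (0 : ℝ) ≤ r - 1) (hh0 t)
      have h4 : Φ t = t * k t + (r - 1) * h t + 3 / (2 * r) * (t ^ 2 * (W t - J z))
        + m / 2 * t ^ 2 := rfl
      have h5 : 0 ≤ 3 / (2 * r) * (t ^ 2 * (W t - J z)) := by
        have := hεpos.le.trans (hεW t hTt)
        positivity
      have h6 : t * (|Φ T| + 1) ≤ m / 2 * t ^ 2 := by
        calc t * (|Φ T| + 1) ≤ t * (m / 2 * t) := by gcongr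
          _ = m / 2 * t ^ 2 := by ring
      have h7 : |Φ T| ≤ t * |Φ T| := le_mul_of_one_le_left (abs_nonneg _) h1t
      have h8 : t * k t ≤ t * (-1) := by linarith [le_abs_self (Φ T)]
      exact le_of_mul_le_mul_left h8 (by linarith)
  exact ⟨L, tendsto_of_tendsto_of_tendsto_of_le_of_le tendsto_const_nhds hL (fun t => hmin _) hJW,
    hmin⟩

variable {d : ℕ}

section Composition

variable {𝕜 𝕜' : Type*} [RCLike 𝕜] [RCLike 𝕜']

lemma integrable_real_smul_of_memLp {U : Set (E d)} {g : E d → ℝ} (hg : Continuous g)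
    (hc : HasCompactSupport g) {f : E d → 𝕜} (hf : MemLp f 2 (volume.restrict U)) :
    Integrable (fun x => g x • f x) (volume.restrict U) := by
  have h1 : MemLp g 2 (volume.restrict U) :=
    (hg.memLp_of_hasCompactSupport hc (μ := volume) (p := 2)).restrict U
  exact memLp_one_iff_integrable.1 (hf.smul h1)

lemma pd_clm_comp (L : 𝕜 →L[ℝ] 𝕜') {φ : E d → 𝕜} (hφ : ContDiff ℝ ∞ φ) (i : Fin d) (x : E d) :
    pd i (fun y => L (φ y)) x = L (pd i φ x) := by
  have h := L.hasFDerivAt.comp x (hφ.differentiable (by simp) x).hasFDerivAt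
  have h2 : fderiv ℝ (fun y => L (φ y)) x = L.comp (fderiv ℝ φ x) := h.fderiv
  simp [pd, h2]

lemma tendsto_eLpNorm_clm_comp {α : Type*} [MeasurableSpace α] {μ : Measure α}
    (L : 𝕜 →L[ℝ] 𝕜') {φ : ℕ → α → 𝕜} {u : α → 𝕜}
    (h : Tendsto (fun n => eLpNorm (φ n - u) 2 μ) atTop (𝓝 0)) :
    Tendsto (fun n => eLpNorm ((fun x => L (φ n x)) - fun x => L (u x)) 2 μ) atTop (𝓝 0) := by
  have h2 : Tendsto (fun n => ‖L‖₊ • eLpNorm (φ n - u) 2 μ) atTop (𝓝 0) := by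
    simp_rw [ENNReal.smul_def, smul_eq_mul]
    simpa using ENNReal.Tendsto.const_mul h (Or.inr ENNReal.coe_ne_top)
  refine tendsto_of_tendsto_of_tendsto_of_le_of_le tendsto_const_nhds h2 (fun _ => zero_le)
    fun n => ?_
  refine eLpNorm_le_nnreal_smul_eLpNorm_of_ae_le_mul (Eventually.of_forall fun x => ?_) 2
  simpa only [Pi.sub_apply, ← map_sub] using L.le_opNNNorm (φ n x - u x)

/-- Traces are compatible with real linear maps between the scalar fields, in particular with real
and imaginary parts, complex conjugation and complexification. -/
lemma HasTrace.clm (L : 𝕜 →L[ℝ] 𝕜') {Ω : Set (E d)} {u : E d → 𝕜} {G : Fin d → E d → 𝕜}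
    {τ : E d → 𝕜} (h : HasTrace Ω u G τ) :
    HasTrace Ω (fun x => L (u x)) (fun i x => L (G i x)) (fun x => L (τ x)) := by
  obtain ⟨⟨hu, hG, hw⟩, hτ, φ, hφ, h1, h2, h3⟩ := h
  refine ⟨⟨L.comp_memLp' hu, fun i => L.comp_memLp' (hG i), fun χ hχ hc hs i => ?_⟩,
    L.comp_memLp' hτ, fun n x => L (φ n x), fun n => L.contDiff.comp (hφ n),
    tendsto_eLpNorm_clm_comp L h1, fun i => ?_, tendsto_eLpNorm_clm_comp L h3⟩
  · have e1 := L.integral_comp_comm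
      (integrable_real_smul_of_memLp (continuous_pd hχ i) (hasCompactSupport_pd hc i) hu)
    have e2 := L.integral_comp_comm (integrable_real_smul_of_memLp hχ.continuous hc (hG i))
    simp only [map_smul] at e1 e2
    rw [e1, e2, hw χ hχ hc hs i, map_neg]
  · have := tendsto_eLpNorm_clm_comp L (h2 i)
    refine this.congr fun n => ?_
    congr 1
    ext x
    simp [pd_clm_comp L (hφ n) i x]

end Composition

/-- The complex Hilbert space of triples (function, gradient, boundary values). -/
abbrev TripleSpace (Ω : Set (E d)) : Type :=
  WithLp 2 (WithLp 2 (Lp ℂ 2 (volume.restrict Ω) ×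
    PiLp 2 (fun _ : Fin d => Lp ℂ 2 (volume.restrict Ω))) × Lp ℂ 2 (surf Ω))

lemma pd_add {φ ψ : E d → ℂ} (hφ : ContDiff ℝ ∞ φ) (hψ : ContDiff ℝ ∞ ψ) (i : Fin d) :
    pd i (φ + ψ) = pd i φ + pd i ψ := by
  ext x
  simp [pd, fderiv_add (hφ.differentiable (by simp) x) (hψ.differentiable (by simp) x)]

lemma pd_const_smul {φ : E d → ℂ} (hφ : ContDiff ℝ ∞ φ) (c : ℂ) (i : Fin d) :
    pd i (c • φ) = c • pd i φ := by
  ext x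
  have h := (hφ.differentiable (by simp) x).hasFDerivAt.const_smul c
  simp [pd, h.fderiv]

lemma continuous_pd_complex {φ : E d → ℂ} (h : ContDiff ℝ ∞ φ) (i : Fin d) :
    Continuous (pd i φ) :=
  (h.continuous_fderiv (by simp)).clm_apply continuous_const

/-- The triples (function, gradient, boundary values) of smooth functions. -/
def smoothTriples (Ω : Set (E d)) : Submodule ℂ (TripleSpace Ω) where
  carrier := {z | ∃ φ : E d → ℂ, ContDiff ℝ ∞ φ ∧ z.fst.fst =ᵐ[volume.restrict Ω] φ ∧
    (∀ i, z.fst.snd i =ᵐ[volume.restrict Ω] pd i φ) ∧ z.snd =ᵐ[surf Ω] φ}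
  zero_mem' := by
    have h0 : ∀ i : Fin d, pd i (0 : E d → ℂ) = 0 := by intro i; ext x; simp [pd]
    exact ⟨0, contDiff_const, Lp.coeFn_zero _ _ _, fun i => by rw [h0]; exact Lp.coeFn_zero _ _ _,
      Lp.coeFn_zero _ _ _⟩
  add_mem' := by
    rintro x y ⟨φ, hφ, h1, h2, h3⟩ ⟨ψ, hψ, k1, k2, k3⟩
    exact ⟨φ + ψ, hφ.add hψ, (Lp.coeFn_add _ _).trans (h1.add k1),
      fun i => by rw [pd_add hφ hψ]; exact (Lp.coeFn_add _ _).trans ((h2 i).add (k2 i)),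
      (Lp.coeFn_add _ _).trans (h3.add k3)⟩
  smul_mem' := by
    rintro c x ⟨φ, hφ, h1, h2, h3⟩
    exact ⟨c • φ, hφ.const_smul c, (Lp.coeFn_smul _ _).trans (h1.const_smul c),
      fun i => by rw [pd_const_smul hφ]; exact (Lp.coeFn_smul _ _).trans ((h2 i).const_smul c),
      (Lp.coeFn_smul _ _).trans (h3.const_smul c)⟩

/-- The closed space of triples (function, weak gradient, trace). -/
def traceSpace (Ω : Set (E d)) : Submodule ℂ (TripleSpace Ω) :=
  (smoothTriples Ω).topologicalClosure

lemma continuous_integral_smul {U : Set (E d)} {g : E d → ℝ} (hg : Continuous g)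
    (hc : HasCompactSupport g) :
    Continuous fun f : Lp ℂ 2 (volume.restrict U) => ∫ x in U, g x • f x := by
  have h1 : MemLp (fun x => (g x : ℂ)) 2 (volume.restrict U) :=
    ((hg.memLp_of_hasCompactSupport hc (μ := volume) (p := 2)).restrict U).ofReal
  have h2 : ∀ f : Lp ℂ 2 (volume.restrict U), ∫ x in U, g x • f x = ⟪h1.toLp, f⟫_ℂ := by
    intro f
    rw [L2.inner_def]
    refine integral_congr_ae ?_
    filter_upwards [h1.coeFn_toLp] with x hx
    rw [hx]
    simp [mul_comm]
  simp_rw [h2]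
  fun_prop

/-- Integration by parts of a smooth function against a test function. -/
lemma setIntegral_pd_smul {U : Set (E d)} {χ : E d → ℝ} (hχ : ContDiff ℝ ∞ χ)
    (hc : HasCompactSupport χ) (hs : tsupport χ ⊆ U) {φ : E d → ℂ} (hφ : ContDiff ℝ ∞ φ)
    (i : Fin d) : ∫ x in U, pd i χ x • φ x = -∫ x in U, χ x • pd i φ x := by
  have hχ0 : ∀ x, x ∉ U → χ x = 0 := fun x hx => image_eq_zero_of_notMem_tsupport fun h => hx (hs h)
  have hp0 : ∀ x, x ∉ U → pd i χ x = 0 := by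
    intro x hx
    have h1 : fderiv ℝ χ x = 0 :=
      image_eq_zero_of_notMem_tsupport fun h => hx (hs (tsupport_fderiv_subset ℝ h))
    simp [pd, h1]
  rw [setIntegral_eq_integral_of_forall_compl_eq_zero fun x hx => by rw [hp0 x hx, zero_smul],
    setIntegral_eq_integral_of_forall_compl_eq_zero fun x hx => by rw [hχ0 x hx, zero_smul],
    eq_neg_iff_add_eq_zero, add_comm, ← eq_neg_iff_add_eq_zero]
  refine integral_smul_fderiv_eq_neg_fderiv_smul_of_integrable ?_ ?_ ?_
    (fun x _ => hχ.differentiable (by simp) x) (fun x _ => hφ.differentiable (by simp) x)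
  · exact ((continuous_pd hχ i).smul hφ.continuous).integrable_of_hasCompactSupport
      (hasCompactSupport_pd hc i).smul_right
  · exact (hχ.continuous.smul (continuous_pd_complex hφ i)).integrable_of_hasCompactSupport
      hc.smul_right
  · exact (hχ.continuous.smul hφ.continuous).integrable_of_hasCompactSupport hc.smul_right

lemma hasWeakGradient_of_mem {Ω : Set (E d)} {z : TripleSpace Ω} (hz : z ∈ traceSpace Ω) :
    HasWeakGradient Ω z.fst.fst (fun i => z.fst.snd i) := by
  intro χ hχ hc hs i
  have hcl : IsClosed {z : TripleSpace Ω |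
      ∫ x in Ω, pd i χ x • z.fst.fst x = -∫ x in Ω, χ x • z.fst.snd i x} := by
    refine isClosed_eq ((continuous_integral_smul (continuous_pd hχ i)
      (hasCompactSupport_pd hc i)).comp (by fun_prop))
      ((continuous_integral_smul hχ.continuous hc).comp (by fun_prop)).neg
  refine closure_minimal ?_ hcl hz
  rintro y ⟨φ, hφ, h1, h2, -⟩
  have e1 : ∫ x in Ω, pd i χ x • y.fst.fst x = ∫ x in Ω, pd i χ x • φ x :=
    integral_congr_ae (by filter_upwards [h1] with x hx; rw [hx])
  have e2 : ∫ x in Ω, χ x • y.fst.snd i x = ∫ x in Ω, χ x • pd i φ x :=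
    integral_congr_ae (by filter_upwards [h2 i] with x hx; rw [hx])
  rw [mem_ofPred_eq, e1, e2, setIntegral_pd_smul hχ hc hs hφ i]

lemma tendsto_eLpNorm_sub_of_tendsto {α : Type*} [MeasurableSpace α] {μ : Measure α}
    {z : ℕ → Lp ℂ 2 μ} {y : Lp ℂ 2 μ} (h : Tendsto z atTop (𝓝 y)) {φ : ℕ → α → ℂ}
    (hφ : ∀ n, z n =ᵐ[μ] φ n) : Tendsto (fun n => eLpNorm (φ n - (y : α → ℂ)) 2 μ) atTop (𝓝 0) := by
  refine (tendsto_iff_edist_tendsto_0.1 h).congr fun n => ?_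
  rw [Lp.edist_def]
  exact eLpNorm_congr_ae ((hφ n).sub (ae_eq_refl _))

/-- Elements of the trace space are functions with a trace. -/
lemma hasTrace_of_mem {Ω : Set (E d)} {z : TripleSpace Ω} (hz : z ∈ traceSpace Ω) :
    HasTrace Ω z.fst.fst (fun i => z.fst.snd i) z.snd := by
  obtain ⟨s, hs, hlim⟩ := mem_closure_iff_seq_limit.1 hz
  choose φ hφ h1 h2 h3 using hs
  refine ⟨⟨Lp.memLp _, fun i => Lp.memLp _, hasWeakGradient_of_mem hz⟩, Lp.memLp _, φ, hφ,
    tendsto_eLpNorm_sub_of_tendsto ?_ h1,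
    fun i => tendsto_eLpNorm_sub_of_tendsto ?_ fun n => h2 n i,
    tendsto_eLpNorm_sub_of_tendsto ?_ h3⟩
  · exact ((by fun_prop : Continuous fun z : TripleSpace Ω => z.fst.fst).tendsto z).comp hlim
  · exact ((by fun_prop : Continuous fun z : TripleSpace Ω => z.fst.snd i).tendsto z).comp hlim
  · exact ((by fun_prop : Continuous fun z : TripleSpace Ω => z.snd).tendsto z).comp hlim

lemma eventually_memLp_of_tendsto {α : Type*} [MeasurableSpace α] {μ : Measure α}
    {u : α → ℂ} (hu : MemLp u 2 μ) {φ : ℕ → α → ℂ} (hφ : ∀ n, AEStronglyMeasurable (φ n) μ)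
    (h : Tendsto (fun n => eLpNorm (φ n - u) 2 μ) atTop (𝓝 0)) : ∀ᶠ n in atTop, MemLp (φ n) 2 μ := by
  filter_upwards [h.eventually_lt_const ENNReal.zero_lt_top] with n hn
  have h1 : MemLp (φ n - u) 2 μ := ⟨(hφ n).sub hu.1, hn⟩
  simpa using h1.add hu

lemma tendsto_toLp_of_tendsto_eLpNorm {α : Type*} [MeasurableSpace α] {μ : Measure α}
    {u : α → ℂ} (hu : MemLp u 2 μ) {φ : ℕ → α → ℂ} (hφ : ∀ n, MemLp (φ n) 2 μ)
    (h : Tendsto (fun n => eLpNorm (φ n - u) 2 μ) atTop (𝓝 0)) :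
    Tendsto (fun n => (hφ n).toLp (φ n)) atTop (𝓝 (hu.toLp u)) := by
  rw [tendsto_iff_edist_tendsto_0]
  exact h.congr fun n => (Lp.edist_toLp_toLp _ _ _ _).symm

/-- A function with a trace defines an element of the trace space. -/
lemma HasTrace.exists_mem {Ω : Set (E d)} {u : E d → ℂ} {G : Fin d → E d → ℂ} {τ : E d → ℂ}
    (h : HasTrace Ω u G τ) : ∃ z ∈ traceSpace Ω, z.fst.fst =ᵐ[volume.restrict Ω] u ∧
      (∀ i, z.fst.snd i =ᵐ[volume.restrict Ω] G i) ∧ z.snd =ᵐ[surf Ω] τ := by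
  obtain ⟨⟨hu, hG, -⟩, hτ, φ, hφ, h1, h2, h3⟩ := h
  have ev : ∀ᶠ n in atTop, MemLp (φ n) 2 (volume.restrict Ω) ∧
      (∀ i, MemLp (pd i (φ n)) 2 (volume.restrict Ω)) ∧ MemLp (φ n) 2 (surf Ω) := by
    refine (eventually_memLp_of_tendsto hu (fun n => (hφ n).continuous.aestronglyMeasurable)
      h1).and (Eventually.and (eventually_all.2 fun i => ?_)
      (eventually_memLp_of_tendsto hτ (fun n => (hφ n).continuous.aestronglyMeasurable) h3))
    exact eventually_memLp_of_tendsto (hG i)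
      (fun n => (continuous_pd_complex (hφ n) i).aestronglyMeasurable) (h2 i)
  obtain ⟨N, hN⟩ := eventually_atTop.1 ev
  have hm : ∀ n, MemLp (φ (n + N)) 2 (volume.restrict Ω) := fun n => (hN _ (by simp)).1
  have hmG : ∀ i n, MemLp (pd i (φ (n + N))) 2 (volume.restrict Ω) := fun i n =>
    (hN _ (by simp)).2.1 i
  have hmτ : ∀ n, MemLp (φ (n + N)) 2 (surf Ω) := fun n => (hN _ (by simp)).2.2
  refine ⟨WithLp.toLp 2 (WithLp.toLp 2 (hu.toLp u, WithLp.toLp 2 fun i => (hG i).toLp (G i)),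
    hτ.toLp τ), ?_, hu.coeFn_toLp, fun i => (hG i).coeFn_toLp, hτ.coeFn_toLp⟩
  refine mem_closure_of_tendsto (b := atTop) (f := fun n : ℕ =>
    (WithLp.toLp 2 (WithLp.toLp 2 ((hm n).toLp _, WithLp.toLp 2 fun i => (hmG i n).toLp _),
      (hmτ n).toLp _) : TripleSpace Ω)) ?_ (Eventually.of_forall fun n => ?_)
  · refine ((WithLp.prod_continuous_toLp _ _ _).tendsto _).comp (Tendsto.prodMk_nhds
      (((WithLp.prod_continuous_toLp _ _ _).tendsto _).comp (Tendsto.prodMk_nhds ?_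
      (((PiLp.continuous_toLp _ _).tendsto _).comp (tendsto_pi_nhds.2 fun i => ?_)))) ?_)
    · exact tendsto_toLp_of_tendsto_eLpNorm hu hm (h1.comp (tendsto_add_atTop_nat N))
    · exact tendsto_toLp_of_tendsto_eLpNorm (hG i) (hmG i) ((h2 i).comp (tendsto_add_atTop_nat N))
    · exact tendsto_toLp_of_tendsto_eLpNorm hτ hmτ (h3.comp (tendsto_add_atTop_nat N))
  · exact ⟨φ (n + N), hφ _, (hm n).coeFn_toLp, fun i => (hmG i n).coeFn_toLp,
      (hmτ n).coeFn_toLp⟩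

/-- Lax–Milgram on a closed subspace `K` of a complex Hilbert space, for a rotated coercive
operator: the variational problem on `K` has a bounded solution operator. -/
theorem exists_variational_solution_operator {X : Type*} [NormedAddCommGroup X]
    [InnerProductSpace ℂ X] [CompleteSpace X] (K : Submodule ℂ X) [CompleteSpace K]
    (M : X →L[ℂ] X) (c : ℂ) (hM : ∀ x, ‖x‖ ^ 2 ≤ (c * ⟪x, M x⟫_ℂ).re) :
    ∃ S : X →L[ℂ] X, ∀ F, S F ∈ K ∧ ∀ y ∈ K, ⟪y, M (S F)⟫_ℂ = ⟪y, F⟫_ℂ := by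
  set T : K →L[ℂ] K := K.orthogonalProjectionOnto ∘L M ∘L K.subtypeL with hT
  have hTi : ∀ x y : K, ⟪y, T x⟫_ℂ = ⟪(y : X), M x⟫_ℂ := fun x y =>
    Submodule.inner_orthogonalProjectionOnto_eq_of_mem_left y (M x)
  have hle : ∀ x : K, ‖x‖ ^ 2 ≤ (c * ⟪x, T x⟫_ℂ).re := fun x => by
    rw [hTi]; exact hM x
  have hbound : ∀ x : K, ‖x‖ ≤ ‖c‖ * ‖T x‖ := by
    intro x
    have h1 : ‖x‖ ^ 2 ≤ ‖c‖ * (‖x‖ * ‖T x‖) :=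
      (hle x).trans ((Complex.re_le_norm _).trans (by
        rw [norm_mul]; gcongr; exact norm_inner_le_norm _ _))
    rcases (norm_nonneg x).eq_or_lt with h0 | h0
    · rw [← h0]; positivity
    · refine le_of_mul_le_mul_left ?_ h0
      linarith
  have hanti : AntilipschitzWith ‖c‖₊ T := T.antilipschitz_of_bound hbound
  have hker : (T : K →ₗ[ℂ] K).ker = ⊥ := LinearMap.ker_eq_bot.2 hanti.injective
  have hclosed : IsClosed ((T : K →ₗ[ℂ] K).range : Set K) :=
    hanti.isClosed_range T.uniformContinuous
  have hrange : (T : K →ₗ[ℂ] K).range = ⊤ := by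
    have := hclosed.completeSpace_coe
    rw [← (T : K →ₗ[ℂ] K).range.orthogonal_orthogonal, Submodule.eq_top_iff']
    intro v w hw
    have h0 : ⟪w, T w⟫_ℂ = 0 := by
      rw [← inner_conj_symm, (hw _ ⟨w, rfl⟩ : ⟪T w, w⟫_ℂ = 0), map_zero]
    have h1 := hle w
    rw [h0, mul_zero, Complex.zero_re] at h1
    have : w = 0 := norm_eq_zero.1 (by nlinarith [norm_nonneg w])
    rw [this, inner_zero_left]
  set e := ContinuousLinearEquiv.ofBijective T hker hrange with he
  refine ⟨K.subtypeL ∘L (e.symm : K →L[ℂ] K) ∘L K.orthogonalProjectionOnto, fun F =>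
    ⟨Submodule.coe_mem _, fun y hy => ?_⟩⟩
  have h1 : T (e.symm (K.orthogonalProjectionOnto F)) = K.orthogonalProjectionOnto F :=
    e.apply_symm_apply _
  have h2 := hTi (e.symm (K.orthogonalProjectionOnto F)) ⟨y, hy⟩
  rw [h1] at h2
  exact h2.symm.trans (Submodule.inner_orthogonalProjectionOnto_eq_of_mem_left ⟨y, hy⟩ F)

/-- The operator representing the Robin form on triples: the identity on the function and the
gradient, multiplication by `i` on the boundary values. -/
def robinOp (Ω : Set (E d)) : TripleSpace Ω →L[ℂ] TripleSpace Ω :=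
  (WithLp.prodContinuousLinearEquiv 2 ℂ _ _).symm.toContinuousLinearMap ∘L
    ((ContinuousLinearMap.id ℂ _).prodMap (Complex.I • ContinuousLinearMap.id ℂ _)) ∘L
    (WithLp.prodContinuousLinearEquiv 2 ℂ _ _).toContinuousLinearMap

/-- The triple representing a volume source and a boundary datum. -/
def robinRhs {Ω : Set (E d)} (f : Lp ℂ 2 (volume.restrict Ω)) (h : Lp ℂ 2 (surf Ω)) :
    TripleSpace Ω :=
  WithLp.toLp 2 (WithLp.toLp 2 (f, 0), h)

lemma inner_robinOp {Ω : Set (E d)} (x y : TripleSpace Ω) :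
    ⟪y, robinOp Ω x⟫_ℂ = ⟪y.fst, x.fst⟫_ℂ + Complex.I * ⟪y.snd, x.snd⟫_ℂ := by
  simp [robinOp, WithLp.prod_inner_apply, inner_smul_right]

lemma inner_robinRhs {Ω : Set (E d)} (f : Lp ℂ 2 (volume.restrict Ω)) (h : Lp ℂ 2 (surf Ω))
    (y : TripleSpace Ω) : ⟪y, robinRhs f h⟫_ℂ = ⟪y.fst.fst, f⟫_ℂ + ⟪y.snd, h⟫_ℂ := by
  simp [robinRhs, WithLp.prod_inner_apply]

lemma robinOp_coercive {Ω : Set (E d)} (x : TripleSpace Ω) :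
    ‖x‖ ^ 2 ≤ ((1 - Complex.I) * ⟪x, robinOp Ω x⟫_ℂ).re := by
  rw [inner_robinOp, inner_self_eq_norm_sq_to_K, inner_self_eq_norm_sq_to_K,
    WithLp.prod_norm_sq_eq_of_L2]
  simp [← Complex.ofReal_pow]

lemma L2_inner_eq_integral {α : Type*} [MeasurableSpace α] {μ : Measure α} {x y : Lp ℂ 2 μ}
    {f g : α → ℂ} (hx : x =ᵐ[μ] f) (hy : y =ᵐ[μ] g) : ⟪y, x⟫_ℂ = ∫ s, f s * conj (g s) ∂μ := by
  rw [L2.inner_def]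
  refine integral_congr_ae ?_
  filter_upwards [hx, hy] with s h1 h2
  rw [h1, h2, RCLike.inner_apply]

lemma integrable_mul_conj_of_memLp {α : Type*} [MeasurableSpace α] {μ : Measure α} {f g : α → ℂ}
    (hf : MemLp f 2 μ) (hg : MemLp g 2 μ) : Integrable (fun s => f s * conj (g s)) μ :=
  hf.integrable_mul (Complex.conjCLE.toContinuousLinearMap.comp_memLp' hg)

lemma inner_fst_eq_integral {Ω : Set (E d)} {x y : TripleSpace Ω} {u ψ : E d → ℂ}
    {G H : Fin d → E d → ℂ} (hu : x.fst.fst =ᵐ[volume.restrict Ω] u)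
    (hG : ∀ i, x.fst.snd i =ᵐ[volume.restrict Ω] G i)
    (hψ : y.fst.fst =ᵐ[volume.restrict Ω] ψ) (hH : ∀ i, y.fst.snd i =ᵐ[volume.restrict Ω] H i) :
    ⟪y.fst, x.fst⟫_ℂ
      = ∫ s in Ω, ((∑ i, G i s * conj (H i s)) + u s * conj (ψ s)) := by
  have hi : ∀ i, Integrable (fun s => G i s * conj (H i s)) (volume.restrict Ω) := fun i =>
    integrable_mul_conj_of_memLp ((memLp_congr_ae (hG i)).1 (Lp.memLp _))
      ((memLp_congr_ae (hH i)).1 (Lp.memLp _))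
  rw [integral_add (integrable_finsetSum _ fun i _ => hi i)
    (integrable_mul_conj_of_memLp ((memLp_congr_ae hu).1 (Lp.memLp _))
      ((memLp_congr_ae hψ).1 (Lp.memLp _))), integral_finsetSum _ fun i _ => hi i,
    WithLp.prod_inner_apply, PiLp.inner_apply, add_comm]
  congr 1
  · exact Finset.sum_congr rfl fun i _ => L2_inner_eq_integral (hG i) (hH i)
  · exact L2_inner_eq_integral hu hψ

/-- Variational solutions in the trace space are weak solutions of the Robin problem. -/
lemma isRobinSolution_of_mem {Ω : Set (E d)} {x : TripleSpace Ω} (hx : x ∈ traceSpace Ω)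
    {F : Lp ℂ 2 (volume.restrict Ω)} {K : Lp ℂ 2 (surf Ω)} {f : E d → ℝ} {h : E d → ℂ}
    (hF : F =ᵐ[volume.restrict Ω] fun s => (f s : ℂ)) (hK : K =ᵐ[surf Ω] h)
    (hxe : ∀ y ∈ traceSpace Ω, ⟪y, robinOp Ω x⟫_ℂ = ⟪y, robinRhs F K⟫_ℂ) :
    IsRobinSolution Ω f h x.fst.fst := by
  refine ⟨_, _, hasTrace_of_mem hx, fun ψ H θ hψ => ?_⟩
  obtain ⟨y, hy, h1, h2, h3⟩ := hψ.exists_mem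
  have := hxe y hy
  rw [inner_robinOp, inner_robinRhs,
    inner_fst_eq_integral (ae_eq_refl _) (fun i => ae_eq_refl _) h1 h2,
    L2_inner_eq_integral (ae_eq_refl _) h3, L2_inner_eq_integral hF h1,
    L2_inner_eq_integral hK h3] at this
  exact this

/-- Weak solutions of the Robin problem are variational solutions in the trace space. -/
lemma IsRobinSolution.exists_mem {Ω : Set (E d)}
    {F : Lp ℂ 2 (volume.restrict Ω)} {K : Lp ℂ 2 (surf Ω)} {f : E d → ℝ} {h u : E d → ℂ}
    (hu : IsRobinSolution Ω f h u)
    (hF : F =ᵐ[volume.restrict Ω] fun s => (f s : ℂ)) (hK : K =ᵐ[surf Ω] h) :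
    ∃ x ∈ traceSpace Ω, x.fst.fst =ᵐ[volume.restrict Ω] u ∧
      ∀ y ∈ traceSpace Ω, ⟪y, robinOp Ω x⟫_ℂ = ⟪y, robinRhs F K⟫_ℂ := by
  obtain ⟨G, τ, ht, he⟩ := hu
  obtain ⟨x, hx, h1, h2, h3⟩ := ht.exists_mem
  refine ⟨x, hx, h1, fun y hy => ?_⟩
  rw [inner_robinOp, inner_robinRhs,
    inner_fst_eq_integral h1 h2 (ae_eq_refl _) (fun i => ae_eq_refl _),
    L2_inner_eq_integral h3 (ae_eq_refl _), L2_inner_eq_integral hF (ae_eq_refl _),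
    L2_inner_eq_integral hK (ae_eq_refl _)]
  exact he _ _ _ (hasTrace_of_mem hy)

lemma traceSpace_isClosed (Ω : Set (E d)) : IsClosed (traceSpace Ω : Set (TripleSpace Ω)) :=
  (smoothTriples Ω).isClosed_topologicalClosure

instance (Ω : Set (E d)) : CompleteSpace (traceSpace Ω) :=
  (traceSpace_isClosed Ω).completeSpace_coe

/-- Solution operator of the Robin problem. -/
def robinSolve (Ω : Set (E d)) : TripleSpace Ω →L[ℂ] TripleSpace Ω :=
  (exists_variational_solution_operator (traceSpace Ω) (robinOp Ω) _ robinOp_coercive).choose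

lemma robinSolve_mem {Ω : Set (E d)} (F : TripleSpace Ω) : robinSolve Ω F ∈ traceSpace Ω :=
  ((exists_variational_solution_operator (traceSpace Ω) (robinOp Ω) _
    robinOp_coercive).choose_spec F).1

lemma robinSolve_spec {Ω : Set (E d)} (F : TripleSpace Ω) : ∀ y ∈ traceSpace Ω,
    ⟪y, robinOp Ω (robinSolve Ω F)⟫_ℂ = ⟪y, F⟫_ℂ :=
  ((exists_variational_solution_operator (traceSpace Ω) (robinOp Ω) _
    robinOp_coercive).choose_spec F).2

lemma eq_robinSolve {Ω : Set (E d)} {x F : TripleSpace Ω} (hx : x ∈ traceSpace Ω)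
    (he : ∀ y ∈ traceSpace Ω, ⟪y, robinOp Ω x⟫_ℂ = ⟪y, F⟫_ℂ) : x = robinSolve Ω F := by
  have hm := Submodule.sub_mem _ hx (robinSolve_mem F)
  have h1 := robinOp_coercive (x - robinSolve Ω F)
  rw [map_sub, inner_sub_right, he _ hm, robinSolve_spec F _ hm, sub_self, mul_zero,
    Complex.zero_re] at h1
  exact sub_eq_zero.1 (norm_eq_zero.1 (by nlinarith [norm_nonneg (x - robinSolve Ω F)]))

/-- Existence for the Robin problem. -/
lemma isRobinSolution_robinSolve {Ω : Set (E d)}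
    {F : Lp ℂ 2 (volume.restrict Ω)} {K : Lp ℂ 2 (surf Ω)} {f : E d → ℝ} {h : E d → ℂ}
    (hF : F =ᵐ[volume.restrict Ω] fun s => (f s : ℂ)) (hK : K =ᵐ[surf Ω] h) :
    IsRobinSolution Ω f h (robinSolve Ω (robinRhs F K)).fst.fst :=
  isRobinSolution_of_mem (robinSolve_mem _) hF hK (robinSolve_spec _)

/-- Uniqueness for the Robin problem. -/
lemma IsRobinSolution.ae_eq {Ω : Set (E d)}
    {F : Lp ℂ 2 (volume.restrict Ω)} {K : Lp ℂ 2 (surf Ω)} {f : E d → ℝ} {h u : E d → ℂ}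
    (hu : IsRobinSolution Ω f h u)
    (hF : F =ᵐ[volume.restrict Ω] fun s => (f s : ℂ)) (hK : K =ᵐ[surf Ω] h) :
    (robinSolve Ω (robinRhs F K)).fst.fst =ᵐ[volume.restrict Ω] u := by
  obtain ⟨x, hx, h1, h2⟩ := hu.exists_mem hF hK
  rwa [eq_robinSolve hx h2] at h1

/-- The solution for vanishing volume source is bounded by the boundary datum. -/
lemma norm_robinSolve_le {Ω : Set (E d)} (K : Lp ℂ 2 (surf Ω)) :
    ‖(robinSolve Ω (robinRhs 0 K)).fst.fst‖ ≤ ‖K‖ := by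
  set x := robinSolve Ω (robinRhs 0 K) with hx
  have h1 := robinSolve_spec (robinRhs 0 K) x (robinSolve_mem _)
  rw [← hx, inner_robinOp, inner_robinRhs, inner_zero_right, zero_add,
    inner_self_eq_norm_sq_to_K, inner_self_eq_norm_sq_to_K] at h1
  have hre := congrArg Complex.re h1
  have him := congrArg Complex.im h1
  simp only [Complex.coe_algebraMap, ← Complex.ofReal_pow, Complex.add_re, Complex.ofReal_re,
    Complex.re_mul_ofReal, Complex.I_re, zero_mul, add_zero, Complex.add_im, Complex.ofReal_im,
    Complex.im_mul_ofReal, Complex.I_im, one_mul, zero_add] at hre him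
  have hb : ‖⟪x.snd, K⟫_ℂ‖ ≤ ‖x.snd‖ * ‖K‖ := norm_inner_le_norm _ _
  have h2 : ‖x.snd‖ ^ 2 ≤ ‖x.snd‖ * ‖K‖ := him ▸ (Complex.im_le_norm _).trans hb
  have h3 : ‖x.fst‖ ^ 2 ≤ ‖x.snd‖ * ‖K‖ := hre ▸ (Complex.re_le_norm _).trans hb
  have h4 : ‖x.fst.fst‖ ^ 2 ≤ ‖x.fst‖ ^ 2 := by
    rw [WithLp.prod_norm_sq_eq_of_L2 x.fst]
    nlinarith [sq_nonneg ‖x.fst.snd‖]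
  have h5 : ‖x.snd‖ ≤ ‖K‖ := by
    by_contra! hlt
    nlinarith [norm_nonneg K]
  refine (sq_le_sq₀ (norm_nonneg _) (norm_nonneg K)).1 ?_
  nlinarith [norm_nonneg K]

/-- Symmetry of the Robin form. -/
lemma IsRobinSolution.integral_mul_comm {Ω : Set (E d)} {f g : E d → ℝ} {u w : E d → ℂ}
    (hu : IsRobinSolution Ω f (fun _ => 0) u) (hw : IsRobinSolution Ω g (fun _ => 0) w) :
    ∫ x in Ω, (f x : ℂ) * w x = ∫ x in Ω, (g x : ℂ) * u x := by
  obtain ⟨G, τ, ht, he⟩ := hu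
  obtain ⟨G', τ', ht', he'⟩ := hw
  have h1 := he _ _ _ (ht'.clm Complex.conjCLE.toContinuousLinearMap)
  have h2 := he' _ _ _ (ht.clm Complex.conjCLE.toContinuousLinearMap)
  simp only [ContinuousLinearEquiv.coe_coe, Complex.conjCLE_apply, Complex.conj_conj, zero_mul,
    integral_zero, add_zero] at h1 h2
  rw [← h1, ← h2]
  simp only [mul_comm]

lemma memLp_indicator_of_restrict {Ω Ω₀ : Set (E d)} (hΩ₀ : IsOpen Ω₀) {f : E d → ℝ}
    (hf : MemLp f 2 (volume.restrict Ω₀)) : MemLp (Ω₀.indicator f) 2 (volume.restrict Ω) :=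
  ((memLp_indicator_iff_restrict hΩ₀.measurableSet).2 hf).restrict Ω

lemma ae_eq_indicator_of_restrict {Ω Ω₀ : Set (E d)} (hΩ₀ : IsOpen Ω₀) {f g : E d → ℝ}
    (hfg : f =ᵐ[volume.restrict Ω₀] g) :
    Ω₀.indicator f =ᵐ[volume.restrict Ω] Ω₀.indicator g := by
  refine ae_restrict_of_ae ?_
  filter_upwards [(ae_restrict_iff' hΩ₀.measurableSet).1 hfg] with x hx
  by_cases h : x ∈ Ω₀
  · simp [h, hx h]
  · simp [h]

/-- Extension by zero, from `L²(Ω₀)` to `L²(Ω)`. -/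
def extendByZero (Ω : Set (E d)) {Ω₀ : Set (E d)} (hΩ₀ : IsOpen Ω₀) : L2 Ω₀ →L[ℝ] L2 Ω :=
  LinearMap.mkContinuous
    { toFun := fun q => (memLp_indicator_of_restrict (Ω := Ω) hΩ₀ (Lp.memLp q)).toLp _
      map_add' := fun p q => by
        rw [← MemLp.toLp_add, MemLp.toLp_eq_toLp_iff, ← indicator_add']
        exact ae_eq_indicator_of_restrict hΩ₀ (Lp.coeFn_add p q)
      map_smul' := fun c q => by
        rw [RingHom.id_apply, ← MemLp.toLp_const_smul, MemLp.toLp_eq_toLp_iff]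
        refine (ae_eq_indicator_of_restrict hΩ₀ (Lp.coeFn_smul c q)).trans (ae_of_all _ fun x => ?_)
        exact indicator_const_smul_apply Ω₀ c q x } 1 fun q => by
    rw [one_mul, LinearMap.coe_mk, AddHom.coe_mk, Lp.norm_toLp, Lp.norm_def]
    refine ENNReal.toReal_mono (Lp.eLpNorm_ne_top q) ?_
    rw [← eLpNorm_indicator_eq_eLpNorm_restrict hΩ₀.measurableSet]
    exact eLpNorm_restrict_le _ _ _ _

lemma coeFn_extendByZero (Ω : Set (E d)) {Ω₀ : Set (E d)} (hΩ₀ : IsOpen Ω₀) (q : L2 Ω₀) :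
    extendByZero Ω hΩ₀ q =ᵐ[volume.restrict Ω] Ω₀.indicator q :=
  (memLp_indicator_of_restrict hΩ₀ (Lp.memLp q)).coeFn_toLp

/-- The complex source `q χ_{Ω₀}` in `L²(Ω; ℂ)`. -/
def complexSource (Ω : Set (E d)) {Ω₀ : Set (E d)} (hΩ₀ : IsOpen Ω₀) :
    L2 Ω₀ →L[ℝ] Lp ℂ 2 (volume.restrict Ω) :=
  Complex.ofRealCLM.compLpL 2 (volume.restrict Ω) ∘L extendByZero Ω hΩ₀

lemma coeFn_complexSource (Ω : Set (E d)) {Ω₀ : Set (E d)} (hΩ₀ : IsOpen Ω₀) (q : L2 Ω₀) :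
    complexSource Ω hΩ₀ q =ᵐ[volume.restrict Ω] fun x => ((Ω₀.indicator (q : E d → ℝ) x : ℝ) : ℂ) := by
  refine (Complex.ofRealCLM.coeFn_compLpL _).trans ?_
  filter_upwards [coeFn_extendByZero Ω hΩ₀ q] with x hx
  exact congrArg Complex.ofReal hx

/-- The imaginary part, from `L²(Ω; ℂ)` to `L²(Ω)`. -/
def imPart (Ω : Set (E d)) : Lp ℂ 2 (volume.restrict Ω) →L[ℝ] L2 Ω :=
  Complex.imCLM.compLpL 2 (volume.restrict Ω)

lemma coeFn_imPart (Ω : Set (E d)) (f : Lp ℂ 2 (volume.restrict Ω)) :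
    imPart Ω f =ᵐ[volume.restrict Ω] fun x => (f x).im :=
  Complex.imCLM.coeFn_compLpL f

lemma norm_imPart_le (Ω : Set (E d)) (f : Lp ℂ 2 (volume.restrict Ω)) : ‖imPart Ω f‖ ≤ ‖f‖ := by
  refine Lp.norm_le_norm_of_ae_le ?_
  filter_upwards [coeFn_imPart Ω f] with x hx
  rw [hx]
  exact Complex.abs_im_le_norm _

/-- The Robin solution as a function of the volume source. -/
def robinSource (Ω : Set (E d)) :
    Lp ℂ 2 (volume.restrict Ω) →L[ℂ] Lp ℂ 2 (volume.restrict Ω) where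
  toFun f := (robinSolve Ω (robinRhs f 0)).fst.fst
  map_add' f g := by
    have : (robinRhs (f + g) 0 : TripleSpace Ω) = robinRhs f 0 + robinRhs g 0 := by
      simp [robinRhs, ← WithLp.toLp_add]
    rw [this, map_add]; rfl
  map_smul' c f := by
    have : (robinRhs (c • f) 0 : TripleSpace Ω) = c • robinRhs f 0 := by
      simp [robinRhs, ← WithLp.toLp_smul]
    rw [this, map_smul]; rfl
  cont := by unfold robinRhs; fun_prop

lemma robinSolve_robinRhs {Ω : Set (E d)} (f : Lp ℂ 2 (volume.restrict Ω)) (h : Lp ℂ 2 (surf Ω)) :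
    (robinSolve Ω (robinRhs f h)).fst.fst
      = robinSource Ω f + (robinSolve Ω (robinRhs 0 h)).fst.fst := by
  have : (robinRhs f h : TripleSpace Ω) = robinRhs f 0 + robinRhs 0 h := by
    simp [robinRhs, ← WithLp.toLp_add]
  rw [this, map_add]; rfl

lemma real_inner_eq_mul (x y : ℝ) : ⟪x, y⟫_ℝ = x * y := by
  rw [RCLike.inner_apply, conj_trivial, mul_comm]

/-- The real operator `q ↦ Im U(q)`, where `U(q)` is the Robin solution with source `q χ_{Ω₀}`. -/
def imSolution (Ω : Set (E d)) {Ω₀ : Set (E d)} (hΩ₀ : IsOpen Ω₀) : L2 Ω₀ →L[ℝ] L2 Ω :=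
  imPart Ω ∘L (robinSource Ω).restrictScalars ℝ ∘L complexSource Ω hΩ₀

lemma norm_sq_eq_integral {U : Set (E d)} {f : L2 U} {g : E d → ℝ}
    (h : f =ᵐ[volume.restrict U] g) : ‖f‖ ^ 2 = ∫ x in U, g x ^ 2 := by
  rw [← real_inner_self_eq_norm_sq, L2.inner_def]
  refine integral_congr_ae ?_
  filter_upwards [h] with x hx
  rw [hx, real_inner_self_eq_norm_sq, Real.norm_eq_abs, sq_abs]

section State

variable {Ω Ω₀ : Set (E d)} {k : SourceKind} {g₁ g₂ : E d → ℝ}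

lemma IsState.ae_eq (hΩ₀ : IsOpen Ω₀) {K : Lp ℂ 2 (surf Ω)} (hK : K =ᵐ[surf Ω] robinData g₁ g₂)
    {p : SourceSpace Ω₀ k} {u : E d → ℂ} (hu : IsState Ω g₁ g₂ p u) :
    (robinSolve Ω (robinRhs (complexSource Ω hΩ₀ (toL2 p)) K)).fst.fst
      =ᵐ[volume.restrict Ω] u :=
  IsRobinSolution.ae_eq hu (coeFn_complexSource Ω hΩ₀ _) hK

lemma isState_state (hΩ₀ : IsOpen Ω₀) {K : Lp ℂ 2 (surf Ω)} (hK : K =ᵐ[surf Ω] robinData g₁ g₂)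
    (p : SourceSpace Ω₀ k) : IsState Ω g₁ g₂ p (state Ω g₁ g₂ p) :=
  Classical.epsilon_spec (p := IsState Ω g₁ g₂ p)
    ⟨_, isRobinSolution_robinSolve (coeFn_complexSource Ω hΩ₀ (toL2 p)) hK⟩

lemma stateImNorm_eq (hΩ₀ : IsOpen Ω₀) {K : Lp ℂ 2 (surf Ω)} (hK : K =ᵐ[surf Ω] robinData g₁ g₂)
    (p : SourceSpace Ω₀ k) : stateImNorm Ω g₁ g₂ p
      = ‖imPart Ω (robinSolve Ω (robinRhs (complexSource Ω hΩ₀ (toL2 p)) K)).fst.fst‖ := by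
  have h1 := (isState_state hΩ₀ hK p).ae_eq hΩ₀ hK
  rw [stateImNorm, ← norm_sq_eq_integral (f := imPart Ω (robinSolve Ω
    (robinRhs (complexSource Ω hΩ₀ (toL2 p)) K)).fst.fst), Real.sqrt_sq (norm_nonneg _)]
  filter_upwards [h1, coeFn_imPart Ω (robinSolve Ω
    (robinRhs (complexSource Ω hΩ₀ (toL2 p)) K)).fst.fst] with x hx hx'
  rw [hx', hx]

lemma V_eq (hΩ₀ : IsOpen Ω₀) {K : Lp ℂ 2 (surf Ω)} (hK : K =ᵐ[surf Ω] robinData g₁ g₂)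
    (p : SourceSpace Ω₀ k) : V Ω g₁ g₂ p = 1 / 2 * ‖imSolution Ω hΩ₀ (toL2 p)
      + imPart Ω (robinSolve Ω (robinRhs 0 K)).fst.fst‖ ^ 2 := by
  rw [V, stateImNorm_eq hΩ₀ hK, robinSolve_robinRhs, map_add]
  rfl

lemma memLp_robinData [IsFiniteMeasure (surf Ω)] (h₁ : MemLp g₁ ∞ (surf Ω))
    (h₂ : MemLp g₂ ∞ (surf Ω)) : MemLp (robinData g₁ g₂) 2 (surf Ω) := by
  have e₁ : MemLp (fun s => (g₁ s : ℂ)) 2 (surf Ω) := (h₁.mono_exponent le_top).ofReal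
  have e₂ : MemLp (fun s => (g₂ s : ℂ)) 2 (surf Ω) := (h₂.mono_exponent le_top).ofReal
  exact e₂.add (e₁.const_mul Complex.I)

/-- An exact source yields a real state for the exact data. -/
lemma IsExactSource.exists_real_state (hΩ₀ : IsOpen Ω₀) [IsFiniteMeasure (surf Ω)]
    (h₂ : MemLp g₂ ∞ (surf Ω)) {p : SourceSpace Ω₀ k} (hp : IsExactSource Ω g₁ g₂ p) :
    ∃ u : E d → ℝ, IsState Ω g₁ g₂ p fun x => (u x : ℂ) := by
  obtain ⟨u, G, ht, he⟩ := hp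
  refine ⟨u, _, _, ht.clm Complex.ofRealCLM, fun ψ H θ hψ => ?_⟩
  have hre := he _ _ _ (hψ.clm Complex.reCLM)
  have him := he _ _ _ (hψ.clm Complex.imCLM)
  have hf : MemLp (sourceTerm p) 2 (volume.restrict Ω) :=
    memLp_indicator_of_restrict hΩ₀ (Lp.memLp (toL2 p))
  have hg₂ : MemLp g₂ 2 (surf Ω) := h₂.mono_exponent le_top
  have hI : Integrable (fun x => (∑ i, (G i x : ℂ) * conj (H i x)) + (u x : ℂ) * conj (ψ x))
      (volume.restrict Ω) :=
    (integrable_finsetSum _ fun i _ => integrable_mul_conj_of_memLp (ht.1.2.1 i).ofReal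
      (hψ.1.2.1 i)).add (integrable_mul_conj_of_memLp ht.1.1.ofReal hψ.1.1)
  have hF : Integrable (fun x => (sourceTerm p x : ℂ) * conj (ψ x)) (volume.restrict Ω) :=
    integrable_mul_conj_of_memLp hf.ofReal hψ.1.1
  have h2θ : Integrable (fun s => (g₂ s : ℂ) * conj (θ s)) (surf Ω) :=
    integrable_mul_conj_of_memLp hg₂.ofReal hψ.2.1
  have h1θ : Integrable (fun s => (g₁ s : ℂ) * conj (θ s)) (surf Ω) :=
    integrable_mul_conj_of_memLp ht.2.1.ofReal hψ.2.1
  have key : ∫ x in Ω, ((∑ i, (G i x : ℂ) * conj (H i x)) + (u x : ℂ) * conj (ψ x))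
      = (∫ x in Ω, (sourceTerm p x : ℂ) * conj (ψ x)) + ∫ s, (g₂ s : ℂ) * conj (θ s) ∂(surf Ω) := by
    apply Complex.ext
    · have e1 := Complex.reCLM.integral_comp_comm hI
      have e2 := Complex.reCLM.integral_comp_comm hF
      have e3 := Complex.reCLM.integral_comp_comm h2θ
      simp only [Complex.reCLM_apply, Complex.add_re, Complex.re_sum, Complex.re_ofReal_mul,
        Complex.conj_re] at e1 e2 e3 hre
      rw [Complex.add_re, ← e1, ← e2, ← e3, hre]
    · have e1 := Complex.imCLM.integral_comp_comm hI
      have e2 := Complex.imCLM.integral_comp_comm hF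
      have e3 := Complex.imCLM.integral_comp_comm h2θ
      simp only [Complex.imCLM_apply, Complex.add_im, Complex.im_sum, Complex.im_ofReal_mul,
        Complex.conj_im, mul_neg, Finset.sum_neg_distrib, ← neg_add, integral_neg] at e1 e2 e3 him
      rw [Complex.add_im, ← e1, ← e2, ← e3, him, neg_add]
  have hsplit : ∫ s, robinData g₁ g₂ s * conj (θ s) ∂(surf Ω)
      = (∫ s, (g₂ s : ℂ) * conj (θ s) ∂(surf Ω))
        + Complex.I * ∫ s, (g₁ s : ℂ) * conj (θ s) ∂(surf Ω) := by
    rw [← integral_const_mul, ← integral_add h2θ (h1θ.const_mul _)]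
    simp only [robinData, add_mul, mul_assoc]
  simp only [Complex.ofRealCLM_apply]
  rw [key, hsplit, add_assoc]

end State

lemma ae_norm_le_of_eLpNorm_top_le {α : Type*} [MeasurableSpace α] {μ : Measure α} {f : α → ℝ}
    {δ : ℝ} (hδ : 0 ≤ δ) (h : eLpNorm f ∞ μ ≤ ENNReal.ofReal δ) : ∀ᵐ x ∂μ, ‖f x‖ ≤ δ := by
  rw [eLpNorm_exponent_top] at h
  filter_upwards [ae_le_eLpNormEssSup (f := f) (μ := μ)] with x hx
  rw [← ofReal_norm] at hx
  exact (ENNReal.ofReal_le_ofReal_iff hδ).1 (hx.trans h)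

/-- A bounded smooth domain has an error constant. -/
theorem exists_isErrorConstant {Ω : Set (E d)} [IsFiniteMeasure (surf Ω)] :
    ∃ C₀ : ℝ, IsErrorConstant Ω C₀ := by
  refine ⟨(surf Ω univ ^ (2 : ℝ≥0∞).toReal⁻¹).toReal * 2, by positivity, ?_⟩
  intro Ω₀ hΩ₀ _ k g₁ g₂ g₁δ g₂δ δ hn p hp
  have hKδ := memLp_robinData hn.noisy₁ hn.noisy₂
  have hK := memLp_robinData hn.exact₁ hn.exact₂
  obtain ⟨u, hu⟩ := hp.exists_real_state hΩ₀ hn.exact₂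
  set F := complexSource Ω hΩ₀ (toL2 p)
  have h0 : imPart Ω (robinSolve Ω (robinRhs F (hK.toLp _))).fst.fst = 0 := by
    refine Lp.ext ?_
    filter_upwards [coeFn_imPart Ω (robinSolve Ω (robinRhs F (hK.toLp _))).fst.fst,
      hu.ae_eq hΩ₀ hK.coeFn_toLp, Lp.coeFn_zero ℝ 2 (volume.restrict Ω)] with x h1 h2 h3
    rw [h1, h2, h3, Complex.ofReal_im, Pi.zero_apply]
  have hdiff : imPart Ω (robinSolve Ω (robinRhs F (hKδ.toLp _))).fst.fst
      = imPart Ω (robinSolve Ω (robinRhs 0 (hKδ.toLp _ - hK.toLp _))).fst.fst := by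
    have e : (robinRhs 0 (hKδ.toLp _ - hK.toLp _) : TripleSpace Ω)
        = robinRhs F (hKδ.toLp _) - robinRhs F (hK.toLp _) := by
      simp [robinRhs, ← WithLp.toLp_sub]
    rw [e, map_sub, WithLp.sub_fst, WithLp.sub_fst, map_sub, h0, sub_zero]
  rw [stateImNorm_eq hΩ₀ hKδ.coeFn_toLp, hdiff]
  refine (norm_imPart_le _ _).trans ((norm_robinSolve_le _).trans ?_)
  rw [← MemLp.toLp_sub, Lp.norm_toLp]
  have hb : ∀ᵐ s ∂(surf Ω), ‖(robinData g₁δ g₂δ - robinData g₁ g₂) s‖ ≤ 2 * δ := by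
    filter_upwards [ae_norm_le_of_eLpNorm_top_le hn.pos.le hn.error₁,
      ae_norm_le_of_eLpNorm_top_le hn.pos.le hn.error₂] with s h1 h2
    have e : (robinData g₁δ g₂δ - robinData g₁ g₂) s
        = (((g₂δ - g₂) s : ℝ) : ℂ) + Complex.I * (((g₁δ - g₁) s : ℝ) : ℂ) := by
      simp only [robinData, Pi.sub_apply, Complex.ofReal_sub]
      ring
    rw [e]
    refine (norm_add_le _ _).trans ?_
    rw [norm_mul, Complex.norm_I, one_mul, Complex.norm_real, Complex.norm_real]
    linarith
  have h2 := ENNReal.toReal_mono (ENNReal.mul_ne_top (ENNReal.rpow_ne_top_of_nonneg (by simp)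
    (measure_ne_top (surf Ω) univ)) ENNReal.ofReal_ne_top) (eLpNorm_le_of_ae_bound (p := 2) hb)
  rw [ENNReal.toReal_mul, ENNReal.toReal_ofReal (by linarith [hn.pos])] at h2
  linarith

/-- The inclusion of the source space into `L²(Ω₀)` as a bounded operator. -/
def toL2CLM (Ω₀ : Set (E d)) : (k : SourceKind) → SourceSpace Ω₀ k →L[ℝ] L2 Ω₀
  | .L2 => ContinuousLinearMap.id ℝ (L2 Ω₀)
  | .H1 => WithLp.fstL 2 ℝ (L2 Ω₀) (PiLp 2 fun _ : Fin d => L2 Ω₀) ∘L (H1 Ω₀).subtypeL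

lemma toL2CLM_apply (Ω₀ : Set (E d)) (k : SourceKind) (p : SourceSpace Ω₀ k) :
    toL2CLM Ω₀ k p = toL2 p := by
  cases k <;> rfl

/-- The adjoint state `w` represents the gradient of the objective functional. -/
lemma setIntegral_adjoint_im {Ω Ω₀ : Set (E d)} (hΩ₀ : IsOpen Ω₀) (hsub : Ω₀ ⊆ Ω) {u w : E d → ℂ}
    (hu : MemLp u 2 (volume.restrict Ω))
    (hw : IsRobinSolution Ω (fun x => (u x).im) (fun _ => 0) w) (q : L2 Ω₀) :
    ∫ x in Ω₀, (w x).im * q x = ∫ x in Ω, (u x).im * imSolution Ω hΩ₀ q x := by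
  set U := (robinSolve Ω (robinRhs (complexSource Ω hΩ₀ q) 0)).fst.fst with hUdef
  have hU : IsRobinSolution Ω (Ω₀.indicator q) (fun _ => 0) U :=
    isRobinSolution_robinSolve (coeFn_complexSource Ω hΩ₀ q) (Lp.coeFn_zero ℂ 2 _)
  have hsymm := congrArg Complex.im (hU.integral_mul_comm hw)
  have hwL : MemLp w 2 (volume.restrict Ω) := by
    obtain ⟨_, _, ht, -⟩ := hw
    exact ht.1.1
  have hq : MemLp (fun x => ((Ω₀.indicator (q : E d → ℝ) x : ℝ) : ℂ)) 2 (volume.restrict Ω) :=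
    (memLp_indicator_of_restrict hΩ₀ (Lp.memLp q)).ofReal
  have hui : MemLp (fun x => ((u x).im : ℂ)) 2 (volume.restrict Ω) := hu.im.ofReal
  have e1 := Complex.imCLM.integral_comp_comm (hq.integrable_mul hwL)
  have e2 := Complex.imCLM.integral_comp_comm (hui.integrable_mul (Lp.memLp U))
  simp only [Complex.imCLM_apply, Pi.mul_apply, Complex.im_ofReal_mul] at e1 e2
  have e3 : ∫ x in Ω, (u x).im * imSolution Ω hΩ₀ q x = ∫ x in Ω, (u x).im * (U x).im := by
    refine integral_congr_ae ?_
    filter_upwards [coeFn_imPart Ω U] with x hx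
    rw [← hx]
    rfl
  rw [e3, e2, ← hsymm, ← e1]
  have e4 : ∀ x, Ω₀.indicator q x * (w x).im = Ω₀.indicator (fun x => (w x).im * q x) x := by
    intro x
    by_cases hx : x ∈ Ω₀
    · simp [hx, mul_comm]
    · simp [hx]
  simp_rw [e4]
  rw [setIntegral_indicator hΩ₀.measurableSet, inter_eq_self_of_subset_right hsub]

end InverseSource

end

open InverseSource in
theorem proposition4p2 (d : ℕ) (hd : d = 2 ∨ d = 3) (Ω : Set (E d))
    (hΩ : IsSmoothBoundedDomain Ω) :
    (∃ C₀ : ℝ, IsErrorConstant Ω C₀) ∧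
    ∀ C₀ : ℝ, IsErrorConstant Ω C₀ →
      ∀ (Ω₀ : Set (E d)), IsOpen Ω₀ → Ω₀ ⊆ Ω →
      ∀ (k : SourceKind) (g₁ g₂ g₁δ g₂δ : E d → ℝ) (δ : ℝ), IsNoisyData Ω g₁ g₂ g₁δ g₂δ δ →
      (∃ pdag : SourceSpace Ω₀ k, IsExactSource Ω g₁ g₂ pdag) →
      ∀ (t₀ : ℝ) (η : ℝ → ℝ), IsDamping t₀ η →
      ∀ (p₀ q₀ : SourceSpace Ω₀ k) (p : ℝ → SourceSpace Ω₀ k),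
        IsDynamicSolution Ω g₁δ g₂δ t₀ η p₀ q₀ p →
        ∃ L : ℝ, Tendsto (fun t => V Ω g₁δ g₂δ (p t)) atTop (𝓝 L) ∧ L ≤ C₀ ^ 2 * δ ^ 2 := by
  have hfin : IsFiniteMeasure (surf Ω) := by
    rcases hd with rfl | rfl <;> exact hΩ.isFiniteMeasure_surf
  refine ⟨exists_isErrorConstant, ?_⟩
  rintro C₀ hC₀ Ω₀ hΩ₀ hsub k g₁ g₂ g₁δ g₂δ δ hn ⟨pdag, hpdag⟩ t₀ η hη p₀ q₀ p
    ⟨v, a, -, -, -, hp, hv, hdyn⟩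
  have hK := memLp_robinData hn.noisy₁ hn.noisy₂
  set b := imPart Ω (robinSolve Ω (robinRhs 0 (hK.toLp _))).fst.fst with hb
  have hVeq : ∀ z : SourceSpace Ω₀ k, V Ω g₁δ g₂δ z
      = 1 / 2 * ‖imSolution Ω hΩ₀ (toL2CLM Ω₀ k z) + b‖ ^ 2 := fun z => by
    rw [V_eq hΩ₀ hK.coeFn_toLp, toL2CLM_apply]
  obtain ⟨L, hL, hmin⟩ := tendsto_quadratic_of_damped_flow (imSolution Ω hΩ₀) b
    (p := fun t => toL2CLM Ω₀ k (p t)) (v := fun t => toL2CLM Ω₀ k (v t))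
    (a := fun t => toL2CLM Ω₀ k (a t)) hη
    (fun t ht => (toL2CLM Ω₀ k).hasFDerivAt.comp_hasDerivAt t
      ((hp t (mem_Ici.2 ht.le)).hasDerivAt (Ici_mem_nhds ht)))
    (fun t ht => (toL2CLM Ω₀ k).hasFDerivAt.comp_hasDerivAt t (hv t ht))
    (fun t ht q => by
      obtain ⟨u, w, hu, hw, heq⟩ := hdyn t ht
      have huL : MemLp u 2 (volume.restrict Ω) := by
        obtain ⟨_, _, htr, -⟩ := hu
        exact htr.1.1
      have hAb : (imSolution Ω hΩ₀ (toL2CLM Ω₀ k (p t)) + b : L2 Ω)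
          =ᵐ[volume.restrict Ω] fun x => (u x).im := by
        have e : imSolution Ω hΩ₀ (toL2CLM Ω₀ k (p t)) + b = imPart Ω (robinSolve Ω
            (robinRhs (complexSource Ω hΩ₀ (toL2 (p t))) (hK.toLp _))).fst.fst := by
          rw [robinSolve_robinRhs, map_add, toL2CLM_apply]
          rfl
        rw [e]
        filter_upwards [coeFn_imPart Ω (robinSolve Ω
          (robinRhs (complexSource Ω hΩ₀ (toL2 (p t))) (hK.toLp _))).fst.fst,
          hu.ae_eq hΩ₀ hK.coeFn_toLp] with x h1 h2
        rw [h1, h2]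
      have hR : inner ℝ (imSolution Ω hΩ₀ (toL2CLM Ω₀ k (p t)) + b) (imSolution Ω hΩ₀ q)
          = ∫ x in Ω, (u x).im * imSolution Ω hΩ₀ q x := by
        rw [L2.inner_def]
        refine integral_congr_ae ?_
        filter_upwards [hAb] with x hx
        rw [hx, real_inner_eq_mul]
      rw [hR, ← setIntegral_adjoint_im hΩ₀ hsub huL hw q, ← integral_neg, L2.inner_def]
      refine integral_congr_ae ?_
      filter_upwards [heq, Lp.coeFn_add (toL2CLM Ω₀ k (a t)) (η t • toL2CLM Ω₀ k (v t)),
        Lp.coeFn_smul (η t) (toL2CLM Ω₀ k (v t))] with x h1 h2 h3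
      rw [h2, Pi.add_apply, h3, Pi.smul_apply, real_inner_eq_mul, toL2CLM_apply, toL2CLM_apply,
        smul_eq_mul, eq_neg_of_add_eq_zero_left h1, neg_mul])
  refine ⟨L, hL.congr fun t => (hVeq (p t)).symm, ?_⟩
  have h1 : L ≤ V Ω g₁δ g₂δ pdag := by rw [hVeq]; exact hmin _
  have h2 := hC₀.2 Ω₀ hΩ₀ hsub k g₁ g₂ g₁δ g₂δ δ hn pdag hpdag
  have h3 : stateImNorm Ω g₁δ g₂δ pdag ^ 2 ≤ (C₀ * δ) ^ 2 :=
    pow_le_pow_left₀ (Real.sqrt_nonneg _) h2 2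
  rw [V] at h1
  nlinarith [sq_nonneg (C₀ * δ)]
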